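/- **Definitions.** For complex $\gamma,\alpha,\beta$ with positive real parts let $\zeta_{B2}(s,\gamma\mid\alpha,\beta)$ be the two-dimensional Barnes zeta function, i.e. the meromorphic continuation in $s$ to $\mathbb C$ of $$\sum_{m,n=0}^\infty \frac{1}{(\gamma+m\alpha+n\beta)^{s}},\qquad \operatorname{Re}s>2,$$ (principal powers), and write $\zeta'_{B2}$ for its derivative in $s$. Let the generalised Bernoulli polynomials of order two be given by $$\frac{\alpha\beta z^2e^{\gamma z}}{(e^{\alpha z}-1)(e^{\beta z}-1)}=\sum_{n\ge0}B^{(2)}_n(\gamma\mid\alpha,\beta)\frac{z^n}{n!}.$$ For an integer $p\ge 2$ put $$K_p(t)=\frac{e^{-t/4}}{(\pi t)^{1/2}}\int_0^\infty e^{-x^2/t}\left[\frac{\coth px}{\sinh 2x}-\frac{1}{2p\sinh^2x}\right]dx\quad(t>0),$$ and let $\zeta_p$, the elliptic zeta function for conformal propagation, be the meromorphic continuation to $\mathbb C$ of $$\zeta_p(s)=\frac1{\Gamma(s)}\int_0^\infty t^{s-1}e^{t/4}K_p(t)\,dt,\qquad \tfrac14<\operatorname{Re}s<\tfrac12 .$$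 **Theorem.** (1) For all complex $\gamma,\alpha,\beta$ with positive real parts, the double series converges absolutely for $\operatorname{Re}s>2$, its meromorphic continuation exists and is analytic away from $s=1,2$, and $$\zeta_{B2}(-1,\gamma\mid\alpha,\beta)=\frac{B^{(2)}_3(\gamma\mid\alpha,\beta)}{6\alpha\beta}=\frac{1}{24\alpha\beta}(2\gamma-\alpha-\beta)\bigl(2\gamma(\gamma-\alpha-\beta)+\alpha\beta\bigr),$$ $$B^{(2)}_3(\gamma\mid\alpha,\beta)=-B^{(2)}_3(\alpha+\beta-\gamma\mid\alpha,\beta).$$ (2) For every integer $p\ge2$ the integrals defining $K_p(t)$, $t>0$, and $\zeta_p(s)$, $\tfrac14<\operatorname{Re}s<\tfrac12$, converge absolutely, the meromorphic continuation of $\zeta_p$ exists, and for all $s\ne1$ with $\cos\pi s\neq0$ $$\zeta_p(s)=\sec(\pi s)\Bigl(\zeta_{B2}(2s,1\mid2,p)+\zeta_{B2}(2s,1+p\mid2,p)-\tfrac1p\,\zeta_{B2}(2s,1\mid1,1)\Bigr).$$ At the secant pole $s=-\tfrac12$ one has $\zeta_{B2}(-1,1\mid2,p)+\zeta_{B2}(-1,1+p\mid2,p)=0$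 and $\zeta_{B2}(-1,1\mid1,1)=0$, so that the residue of $\zeta_p$ there, $\lim_{s\to-1/2}(s+\tfrac12)\zeta_p(s)$, is zero; $\zeta_p$ is analytic at $s=-\tfrac12$, and $$\zeta_p(-\tfrac12)=\frac2\pi\Bigl(\zeta'_{B2}(-1,1\mid2,p)+\zeta'_{B2}(-1,1+p\mid2,p)-\tfrac1p\,\zeta'_{B2}(-1,1\mid1,1)\Bigr).$$ -/

import Mathlib

open Set Filter Topology MeasureTheory

noncomputable section

/-! ### Meromorphic continuation to the whole plane -/

/-- `F` is the meromorphic continuation to `ℂ` of the function `f` given on `U`. The normal form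
condition says that `F` is meromorphic everywhere, analytic at every point that is not a pole
(removable singularities are removed), and has the conventional value `0` at the poles. -/
def IsMeromorphicContinuation (U : Set ℂ) (f F : ℂ → ℂ) : Prop :=
  MeromorphicNFOn F univ ∧ EqOn F f U

/-- There is at most one meromorphic continuation from a non-empty open set. -/
theorem IsMeromorphicContinuation.unique {U : Set ℂ} {f F G : ℂ → ℂ} (hU : IsOpen U)
    (hne : U.Nonempty) (hF : IsMeromorphicContinuation U f F)
    (hG : IsMeromorphicContinuation U f G) : F = G := by
  have mF : MeromorphicOn F univ := hF.1.meromorphicOn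
  have mG : MeromorphicOn G univ := hG.1.meromorphicOn
  obtain ⟨u, hu⟩ := hne
  have hloc : ∀ᶠ z in 𝓝[≠] u, (F - G) z = 0 := by
    refine Filter.Eventually.filter_mono nhdsWithin_le_nhds ?_
    filter_upwards [hU.mem_nhds hu] with z hz
    simp [hF.2 hz, hG.2 hz]
  have hall : ∀ x, meromorphicOrderAt (F - G) x = ⊤ := by
    intro x
    by_contra hx
    exact (mF.sub mG).meromorphicOrderAt_ne_top_of_isPreconnected isPreconnected_univ
      (mem_univ x) (mem_univ u) hx (meromorphicOrderAt_eq_top_iff.2 hloc)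
  funext x
  have hx : F =ᶠ[𝓝[≠] x] G := by
    filter_upwards [meromorphicOrderAt_eq_top_iff.1 (hall x)] with z hz
    exact sub_eq_zero.1 hz
  exact (((hF.1 (mem_univ x)).eventuallyEq_nhdsNE_iff_eventuallyEq_nhds
    (hG.1 (mem_univ x))).1 hx).eq_of_nhds

open Classical in
/-- The meromorphic continuation to `ℂ` of the function `f` given on `U`
(the zero function if there is none). -/
def meromorphicContinuation (U : Set ℂ) (f : ℂ → ℂ) : ℂ → ℂ :=
  if h : ∃ F, IsMeromorphicContinuation U f F then h.choose else 0

/-! ### The two-dimensional Barnes zeta function -/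

/-- The general term of the Barnes double series. -/
def barnesTerm (γ α β s : ℂ) (mn : ℕ × ℕ) : ℂ :=
  1 / (γ + mn.1 * α + mn.2 * β) ^ s

/-- The Barnes double series `∑_{m,n ≥ 0} (γ + mα + nβ)^{-s}`, for `Re s > 2`. -/
def barnesSeries (γ α β s : ℂ) : ℂ := ∑' mn : ℕ × ℕ, barnesTerm γ α β s mn

/-- The two-dimensional Barnes zeta function `s ↦ ζ_{B2}(s, γ | α, β)`, continued to `ℂ`. -/
def barnesZeta (γ α β : ℂ) : ℂ → ℂ :=
  meromorphicContinuation {s | 2 < s.re} (barnesSeries γ α β)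

/-! ### Generalised Bernoulli polynomials of order two -/

/-- The power series `(e^{αz} - 1) / z = ∑ α^{k+1} z^k / (k+1)!`. -/
def expSubOneDiv (α : ℂ) : PowerSeries ℂ :=
  PowerSeries.mk fun k => α ^ (k + 1) / ((k + 1).factorial : ℂ)

/-- The defining relation of `expSubOneDiv`. -/
theorem X_mul_expSubOneDiv (α : ℂ) :
    PowerSeries.X * expSubOneDiv α = PowerSeries.rescale α (PowerSeries.exp ℂ) - 1 := by
  ext n
  cases n with
  | zero =>
    rw [map_sub, PowerSeries.coeff_rescale]
    simp [PowerSeries.coeff_exp]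
  | succ n =>
    simp [PowerSeries.coeff_succ_X_mul, expSubOneDiv, PowerSeries.coeff_rescale,
      PowerSeries.coeff_exp, PowerSeries.coeff_one, div_eq_mul_inv]

/-- The generalised Bernoulli polynomial `B^{(2)}_n(γ | α, β)` for non-zero `α`, `β`, given by
`αβ z² e^{γz} / ((e^{αz} - 1)(e^{βz} - 1)) = ∑ B^{(2)}_n(γ | α, β) zⁿ / n!`. -/
def genBernoulli (n : ℕ) (γ α β : ℂ) : ℂ :=
  (n.factorial : ℂ) * PowerSeries.coeff n
    (PowerSeries.C (α * β) * PowerSeries.rescale γ (PowerSeries.exp ℂ) *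
      (expSubOneDiv α)⁻¹ * (expSubOneDiv β)⁻¹)

/-! ### The elliptic zeta function -/

/-- The bracket `coth(px) / sinh(2x) - 1 / (2p sinh² x)`. -/
def ellipticBracket (p : ℕ) (x : ℝ) : ℝ :=
  Real.cosh (p * x) / Real.sinh (p * x) / Real.sinh (2 * x) - 1 / (2 * p * Real.sinh x ^ 2)

/-- The elliptic heat kernel
`K_p(t) = (πt)^{-1/2} e^{-t/4} ∫₀^∞ e^{-x²/t} [coth(px)/sinh(2x) - 1/(2p sinh² x)] dx`. -/
def ellipticHeatKernel (p : ℕ) (t : ℝ) : ℝ :=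
  1 / Real.sqrt (Real.pi * t) * Real.exp (-t / 4) *
    ∫ x in Ioi (0 : ℝ), Real.exp (-x ^ 2 / t) * ellipticBracket p x

/-- The conformally weighted heat kernel `e^{t/4} K_p(t)`, with complex values. -/
def conformalHeatKernel (p : ℕ) (t : ℝ) : ℂ :=
  ((Real.exp (t / 4) * ellipticHeatKernel p t : ℝ) : ℂ)

/-- The strip `1/4 < Re s < 1/2`. -/
def ellipticStrip : Set ℂ := {s | 1 / 4 < s.re ∧ s.re < 1 / 2}

/-- The Mellin relation `ζ_p(s) = Γ(s)⁻¹ ∫₀^∞ t^{s-1} e^{t/4} K_p(t) dt`, valid in the strip. -/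
def ellipticZetaMellin (p : ℕ) (s : ℂ) : ℂ :=
  1 / Complex.Gamma s * mellin (conformalHeatKernel p) s

/-- The elliptic zeta function `ζ_p`, continued to `ℂ`. -/
def ellipticZeta (p : ℕ) : ℂ → ℂ :=
  meromorphicContinuation ellipticStrip (ellipticZetaMellin p)

end

/-! Everything reduces to one kernel, `barnesKernel`. Expanding its denominators in geometric series
and integrating termwise shows that the Barnes series is `Γ(s)⁻¹` times the Mellin transform of the
kernel at `s - 2` (`hasSum_barnesTerm`). The factor `t²` makes the kernel regular at `0`; its price
is `Γ(s) = (s - 1)(s - 2) Γ(s - 2)`, hence the possible poles at `1` and `2`.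

If `f` decays exponentially and `e^t f(t) ~ ∑ c_k t^k` at `0+`, then subtracting `e^{-t} c_k t^k`
for `k < N` gives convergence for `Re u > -N`. Each subtracted term has transform `c_k Γ(u + k) =
c_k (u)_k Γ(u)`, so after division by `Γ(u)` it contributes a polynomial and the continuation is
entire (`MellinRegular.differentiable_entireMellin`). At `u = -3` the factor `1/Γ` vanishes and only
polynomials in the first four coefficients remain; they give `ζ_{B2}(-1)`.

For the elliptic part, the bracket at `x` is a combination of three Barnes kernels at `2x`
(`ellipticBracket_eq`). Fubini and `∫ t^{s-3/2} e^{-x²/t} dt = Γ(1/2 - s) x^{2s-1}` turn the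
transform of the heat kernel at `s` into that of the bracket at `2s`. The Gamma factors collapse to
`sec πs` by duplication and reflection (`inv_Gamma_mul_Gamma_half_sub_mul_Gamma_two_mul`).

The reflection `γ ↦ α + β - γ` changes the sign of `ζ_{B2}(-1)`. For periods `(2, p)` it swaps `1`
and `1 + p`; for `(1, 1)` it fixes `1`. So the Barnes combination vanishes at `-1`, the simple zero
of `cos πs` at `-1/2` is cancelled, and the value there is a quotient of derivatives. -/

/-! ### Asymptotic power series at `0+` -/

/-- `p` is the asymptotic power series of `f` at `0` from the right. -/
def HasAsympSeries (f : ℝ → ℂ) (p : PowerSeries ℂ) : Prop :=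
  ∀ N : ℕ, (fun t : ℝ => f t - (p.trunc N).eval (t : ℂ)) =O[𝓝[>] 0] fun t : ℝ => t ^ N

theorem isBigO_eval_ofReal_of_coeff_eq_zero {P : Polynomial ℂ} {N : ℕ}
    (hP : ∀ k < N, P.coeff k = 0) :
    (fun t : ℝ => P.eval (t : ℂ)) =O[𝓝[>] 0] fun t : ℝ => t ^ N := by
  obtain ⟨Q, rfl⟩ := Polynomial.X_pow_dvd_iff.2 hP
  have hQ : (fun t : ℝ => Q.eval (t : ℂ)) =O[𝓝[>] 0] fun _ : ℝ => (1 : ℝ) := by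
    have hc : Continuous fun t : ℝ => Q.eval (t : ℂ) := by fun_prop
    exact ((hc.tendsto 0).mono_left nhdsWithin_le_nhds).isBigO_one ℝ
  have hX : (fun t : ℝ => (t : ℂ) ^ N) =O[𝓝[>] 0] fun t : ℝ => t ^ N :=
    Asymptotics.IsBigO.of_bound 1 (Eventually.of_forall fun t => by simp)
  simpa using hX.mul hQ

theorem HasAsympSeries.isBigO_one {f : ℝ → ℂ} {p : PowerSeries ℂ} (hf : HasAsympSeries f p) :
    f =O[𝓝[>] 0] fun _ : ℝ => (1 : ℝ) := by
  simpa using hf 0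

theorem HasAsympSeries.tendsto {f : ℝ → ℂ} {p : PowerSeries ℂ} (hf : HasAsympSeries f p) :
    Tendsto f (𝓝[>] 0) (𝓝 (PowerSeries.coeff 0 p)) := by
  have h1 : Tendsto (fun t : ℝ => t ^ 1) (𝓝[>] 0) (𝓝 0) := by
    have : Tendsto (fun t : ℝ => t ^ 1) (𝓝 0) (𝓝 (0 ^ 1)) := (continuous_pow 1).tendsto 0
    simpa using this.mono_left nhdsWithin_le_nhds
  have h2 := (hf 1).trans_tendsto h1
  have h3 := h2.add_const (PowerSeries.coeff 0 p)
  simpa [PowerSeries.trunc_one_left] using h3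

/-- Writing `p_N` for truncation, `fg - (pq)_N = (f - p_N) g + p_N (g - q_N) + (p_N q_N - (pq)_N)`.
The last polynomial has no terms below degree `N`. -/
theorem HasAsympSeries.mul {f g : ℝ → ℂ} {p q : PowerSeries ℂ} (hf : HasAsympSeries f p)
    (hg : HasAsympSeries g q) : HasAsympSeries (fun t => f t * g t) (p * q) := by
  intro N
  have h1 := (hf N).mul hg.isBigO_one
  have hc : (fun t : ℝ => (p.trunc N).eval (t : ℂ)) =O[𝓝[>] 0] fun _ : ℝ => (1 : ℝ) := by
    simpa using isBigO_eval_ofReal_of_coeff_eq_zero (P := p.trunc N) (N := 0) (by simp)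
  have h2 := hc.mul (hg N)
  have h3 := isBigO_eval_ofReal_of_coeff_eq_zero
    (P := p.trunc N * q.trunc N - (p * q).trunc N) (N := N) (by
      intro k hk
      have := congrArg (fun P : Polynomial ℂ => P.coeff k)
        (PowerSeries.trunc_trunc_mul_trunc (n := N) p q)
      simp only [PowerSeries.coeff_trunc, hk, if_true] at this
      rw [Polynomial.coeff_sub, PowerSeries.coeff_trunc, if_pos hk, ← this,
        ← Polynomial.coe_mul, Polynomial.coeff_coe, sub_self])
  have h4 := ((by simpa using h1 : _ =O[𝓝[>] 0] fun t : ℝ => t ^ N).add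
    (by simpa using h2 : _ =O[𝓝[>] 0] fun t : ℝ => t ^ N)).add h3
  refine h4.congr_left fun t => ?_
  simp only [Polynomial.eval_sub, Polynomial.eval_mul]
  ring

theorem hasAsympSeries_coe (P : Polynomial ℂ) :
    HasAsympSeries (fun t : ℝ => P.eval (t : ℂ)) (P : PowerSeries ℂ) := by
  intro N
  refine (isBigO_eval_ofReal_of_coeff_eq_zero
    (P := P - (P : PowerSeries ℂ).trunc N) (N := N) ?_).congr_left fun t => by simp
  intro k hk
  rw [Polynomial.coeff_sub, PowerSeries.coeff_trunc, if_pos hk, Polynomial.coeff_coe, sub_self]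

theorem HasAsympSeries.inv {f : ℝ → ℂ} {p : PowerSeries ℂ} (hf : HasAsympSeries f p)
    (h0 : PowerSeries.constantCoeff p ≠ 0) : HasAsympSeries (fun t => (f t)⁻¹) p⁻¹ := by
  intro N
  have h0' : PowerSeries.coeff 0 p ≠ 0 := by simpa using h0
  have hlim := hf.tendsto
  have hne : ∀ᶠ t in 𝓝[>] (0 : ℝ), f t ≠ 0 := hlim.eventually_ne h0'
  have hinv : (fun t => (f t)⁻¹) =O[𝓝[>] 0] fun _ : ℝ => (1 : ℝ) :=
    (hlim.inv₀ h0').isBigO_one ℝ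
  -- With `r` the truncation of `p⁻¹`, write `1/f - r = (1/f)(1 - f r)`. The product `f r` has
  -- series `p r`, which agrees with `1` below degree `N`.
  have h1 := hf.mul (hasAsympSeries_coe (p⁻¹.trunc N)) N
  have h2 := isBigO_eval_ofReal_of_coeff_eq_zero
    (P := 1 - (p * (p⁻¹.trunc N : PowerSeries ℂ)).trunc N) (N := N) (by
      intro k hk
      have h3 : (p * (p⁻¹.trunc N : PowerSeries ℂ)).trunc N = (p * p⁻¹).trunc N :=
        PowerSeries.trunc_mul_trunc p p⁻¹
      rw [h3, PowerSeries.mul_inv_cancel p h0, Polynomial.coeff_sub, PowerSeries.coeff_trunc,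
        if_pos hk, PowerSeries.coeff_one, Polynomial.coeff_one]
      simp)
  have h4 := hinv.mul (h2.sub h1)
  simp only [one_mul] at h4
  refine h4.congr' ?_ EventuallyEq.rfl
  filter_upwards [hne] with t ht
  simp only [Polynomial.eval_sub, Polynomial.eval_one]
  field_simp
  ring

theorem HasAsympSeries.congr {f g : ℝ → ℂ} {p : PowerSeries ℂ} (hf : HasAsympSeries f p)
    (h : f =ᶠ[𝓝[>] 0] g) : HasAsympSeries g p := fun N =>
  (hf N).congr' (by filter_upwards [h] with t ht using by rw [ht]) EventuallyEq.rfl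

theorem eval_trunc (p : PowerSeries ℂ) (N : ℕ) (z : ℂ) :
    (p.trunc N).eval z = ∑ k ∈ Finset.range N, PowerSeries.coeff k p * z ^ k := by
  simpa [Polynomial.eval₂_id] using PowerSeries.eval₂_trunc_eq_sum_range z (RingHom.id ℂ) N p

theorem hasAsympSeries_exp (a : ℂ) :
    HasAsympSeries (fun t : ℝ => Complex.exp (a * t))
      (PowerSeries.rescale a (PowerSeries.exp ℂ)) := by
  intro N
  refine Asymptotics.IsBigO.of_bound (‖a‖ ^ N / N.factorial * 2) ?_
  have hsmall : ∀ᶠ t : ℝ in 𝓝 0, ‖a * (t : ℂ)‖ / (N.succ : ℝ) < 1 / 2 := by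
    have hc : Continuous fun t : ℝ => ‖a * (t : ℂ)‖ / (N.succ : ℝ) := by fun_prop
    refine (hc.tendsto 0).eventually_lt_const ?_
    simp
  filter_upwards [nhdsWithin_le_nhds hsmall] with t ht
  have h := Complex.exp_bound' ht.le
  rw [eval_trunc]
  simp only [PowerSeries.coeff_rescale, PowerSeries.coeff_exp]
  calc _ = ‖Complex.exp (a * t) - ∑ m ∈ Finset.range N, (a * (t : ℂ)) ^ m / m.factorial‖ := by
        congr 2
        refine Finset.sum_congr rfl fun k _ => ?_
        simp [mul_pow, div_eq_mul_inv]
        ring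
    _ ≤ _ := h
    _ = _ := by
        simp [mul_pow]
        ring

theorem hasAsympSeries_expSubOneDiv (a : ℂ) :
    HasAsympSeries (fun t : ℝ => (Complex.exp (a * t) - 1) / t) (expSubOneDiv a) := by
  intro N
  -- Division by `t` costs one order, so one more term of the exponential is needed; its constant
  -- term cancels the `-1`.
  have h := hasAsympSeries_exp a (N + 1)
  have hinv : (fun t : ℝ => ((t : ℂ))⁻¹) =O[𝓝[>] 0] fun t : ℝ => t⁻¹ :=
    Asymptotics.IsBigO.of_bound 1 (Eventually.of_forall fun t => by simp)
  refine (hinv.mul h).congr' ?_ ?_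
  · filter_upwards [self_mem_nhdsWithin] with t ht
    have ht0 : (t : ℂ) ≠ 0 := by exact_mod_cast (mem_Ioi.1 ht).ne'
    rw [eval_trunc, eval_trunc, Finset.sum_range_succ']
    simp only [PowerSeries.coeff_rescale, PowerSeries.coeff_exp, expSubOneDiv,
      PowerSeries.coeff_mk, pow_succ (t : ℂ), ← mul_assoc, ← Finset.sum_mul]
    simp only [pow_zero, Nat.factorial_zero, Nat.cast_one, div_one, map_one, mul_one]
    field_simp
    have : ∀ k : ℕ,
        algebraMap ℚ ℂ (1 / ((k + 1).factorial : ℚ)) = 1 / ((k + 1).factorial : ℂ) := by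
      intro k; simp
    simp only [this]
    simp only [mul_one_div]
    ring_nf
  · filter_upwards [self_mem_nhdsWithin] with t ht
    have ht0 : t ≠ 0 := (mem_Ioi.1 ht).ne'
    field_simp
    ring

/-! ### Mellin transforms -/

theorem integrableOn_rpow_sub_one_mul_exp_neg_mul {σ a : ℝ} (hσ : 0 < σ) (ha : 0 < a) :
    IntegrableOn (fun t : ℝ => t ^ (σ - 1) * Real.exp (-a * t)) (Ioi 0) := by
  simpa using integrableOn_rpow_mul_exp_neg_mul_rpow (p := 1) (s := σ - 1) (b := a)
    (by linarith) one_pos ha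

theorem norm_cpow_mul_cexp_neg_mul {s w : ℂ} {t : ℝ} (ht : 0 < t) :
    ‖(t : ℂ) ^ (s - 1) * Complex.exp (-w * t)‖ = t ^ (s.re - 1) * Real.exp (-w.re * t) := by
  rw [norm_mul, Complex.norm_cpow_eq_rpow_re_of_pos ht, Complex.norm_exp]
  simp

theorem continuousOn_cpow_mul {s : ℂ} {f : ℝ → ℂ} (hf : ContinuousOn f (Ioi 0)) :
    ContinuousOn (fun t : ℝ => (t : ℂ) ^ (s - 1) * f t) (Ioi 0) := by
  refine ContinuousOn.mul (fun t ht => ?_) hf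
  exact (Complex.continuousAt_ofReal_cpow_const t (s - 1)
    (Or.inr (mem_Ioi.1 ht).ne')).continuousWithinAt

theorem integrableOn_cpow_mul_cexp_neg_mul {s w : ℂ} (hs : 0 < s.re) (hw : 0 < w.re) :
    IntegrableOn (fun t : ℝ => (t : ℂ) ^ (s - 1) * Complex.exp (-w * t)) (Ioi 0) := by
  refine (integrableOn_rpow_sub_one_mul_exp_neg_mul hs hw).mono' ?_ ?_
  · exact (continuousOn_cpow_mul (by fun_prop)).aestronglyMeasurable measurableSet_Ioi
  · filter_upwards [ae_restrict_mem measurableSet_Ioi] with t ht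
    rw [norm_cpow_mul_cexp_neg_mul ht]

theorem mellinConvergent_cexp_neg_mul {s w : ℂ} (hs : 0 < s.re) (hw : 0 < w.re) :
    MellinConvergent (fun t : ℝ => Complex.exp (-w * t)) s := by
  simpa [MellinConvergent, smul_eq_mul] using integrableOn_cpow_mul_cexp_neg_mul hs hw

theorem differentiableAt_mellin_cexp_neg_mul {s w : ℂ} (hs : 0 < s.re) (hw : 0 < w.re) :
    DifferentiableAt ℂ (fun w : ℂ => mellin (fun t : ℝ => Complex.exp (-w * t)) s) w := by
  -- Differentiation in `w` brings down `-t`. On the half-plane `Re v > Re w / 2` the result is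
  -- dominated by `t^{Re s} e^{-(Re w / 2) t}`.
  have h := hasDerivAt_integral_of_dominated_loc_of_deriv_le
    (μ := volume.restrict (Ioi (0 : ℝ))) (x₀ := w) (s := {v : ℂ | w.re / 2 < v.re})
    (F := fun v t => (t : ℂ) ^ (s - 1) * Complex.exp (-v * t))
    (F' := fun v t => -((t : ℂ) ^ (s + 1 - 1) * Complex.exp (-v * t)))
    (bound := fun t => t ^ ((s + 1).re - 1) * Real.exp (-(w.re / 2) * t))
    ((isOpen_lt continuous_const Complex.continuous_re).mem_nhds (by simp; linarith))
    (Eventually.of_forall fun v =>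
      (continuousOn_cpow_mul (by fun_prop)).aestronglyMeasurable measurableSet_Ioi)
    (integrableOn_cpow_mul_cexp_neg_mul hs hw)
    ((continuousOn_cpow_mul (by fun_prop)).aestronglyMeasurable measurableSet_Ioi).neg
    ?_ (integrableOn_rpow_sub_one_mul_exp_neg_mul (by simp; linarith) (by linarith)) ?_
  · simpa only [mellin, smul_eq_mul] using h.2.differentiableAt
  · filter_upwards [ae_restrict_mem measurableSet_Ioi] with t ht v hv
    rw [norm_neg, norm_cpow_mul_cexp_neg_mul ht]
    have ht' : 0 < t := ht
    have hv' : w.re / 2 < v.re := hv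
    gcongr
  · filter_upwards [ae_restrict_mem measurableSet_Ioi] with t ht v hv
    have ht0 : (t : ℂ) ≠ 0 := by exact_mod_cast (mem_Ioi.1 ht).ne'
    have h1 : HasDerivAt (fun v : ℂ => Complex.exp (-v * t)) (Complex.exp (-v * t) * (-1 * t)) v :=
      ((hasDerivAt_neg v).mul_const (t : ℂ)).cexp
    have h2 := h1.const_mul ((t : ℂ) ^ (s - 1))
    have h3 : -((t : ℂ) ^ (s + 1 - 1) * Complex.exp (-v * t)) =
        (t : ℂ) ^ (s - 1) * (Complex.exp (-v * t) * (-1 * t)) := by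
      rw [show s + 1 - 1 = (s - 1) + 1 by ring, Complex.cpow_add _ _ ht0, Complex.cpow_one]
      ring
    rwa [h3]

/-- `∫₀^∞ t^{s-1} e^{-wt} dt = Γ(s) w^{-s}` in the right half-plane of `w`. -/
theorem mellin_cexp_neg_mul {s w : ℂ} (hs : 0 < s.re) (hw : 0 < w.re) :
    mellin (fun t : ℝ => Complex.exp (-w * t)) s = Complex.Gamma s * w ^ (-s) := by
  have hopen : IsOpen {v : ℂ | 0 < v.re} := isOpen_lt continuous_const Complex.continuous_re
  have h1 : AnalyticOnNhd ℂ (fun v : ℂ => mellin (fun t : ℝ => Complex.exp (-v * t)) s)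
      {v : ℂ | 0 < v.re} :=
    DifferentiableOn.analyticOnNhd
      (fun v hv => (differentiableAt_mellin_cexp_neg_mul hs hv).differentiableWithinAt) hopen
  have h2 : AnalyticOnNhd ℂ (fun v : ℂ => Complex.Gamma s * v ^ (-s)) {v : ℂ | 0 < v.re} := by
    refine DifferentiableOn.analyticOnNhd (fun v hv => ?_) hopen
    exact ((differentiableAt_id.cpow_const (Or.inl hv)).const_mul _).differentiableWithinAt
  have hreal : ∀ r : ℝ, 0 < r → mellin (fun t : ℝ => Complex.exp (-(r : ℂ) * t)) s =
      Complex.Gamma s * (r : ℂ) ^ (-s) := by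
    intro r hr
    have := Complex.integral_cpow_mul_exp_neg_mul_Ioi hs hr
    simp only [mellin, smul_eq_mul, neg_mul, this]
    have harg : (r : ℂ).arg ≠ Real.pi := by
      rw [Complex.arg_ofReal_of_nonneg hr.le]
      exact Real.pi_pos.ne
    rw [one_div, Complex.inv_cpow _ _ harg, Complex.cpow_neg]
    ring
  -- Both sides are analytic in `w` and agree for positive real `w` by the Gamma integral. The
  -- points `1 + 1/(n+1)` accumulate at `1`, so the identity theorem applies.
  refine h1.eqOn_of_preconnected_of_frequently_eq h2
    (convex_halfSpace_re_gt 0).isPreconnected (z₀ := 1) (by simp) ?_ hw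
  have htend : Tendsto (fun n : ℕ => ((1 + 1 / ((n : ℝ) + 1) : ℝ) : ℂ)) atTop (𝓝[≠] 1) := by
    refine tendsto_nhdsWithin_iff.2 ⟨?_, Eventually.of_forall fun n => ?_⟩
    · have := (Complex.continuous_ofReal.tendsto _).comp
        ((tendsto_one_div_add_atTop_nhds_zero_nat (𝕜 := ℝ)).const_add 1)
      simpa [Function.comp_def] using this
    · have : (0 : ℝ) < 1 / ((n : ℝ) + 1) := by positivity
      simp only [mem_compl_iff, mem_singleton_iff]
      intro h
      have h' : 1 + 1 / ((n : ℝ) + 1) = 1 := by exact_mod_cast h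
      linarith
  exact htend.frequently (Eventually.of_forall fun n => hreal _ (by positivity)).frequently

/-! ### Entire continuation of Mellin transforms by subtracting asymptotic terms. -/

/-- Valid at the poles of `Γ` as well: there `Complex.Gamma` takes the value `0`, so its inverse is
the true value of the entire function `1/Γ`. -/
theorem inv_Gamma_eq_ascPochhammer_mul (u : ℂ) (N : ℕ) :
    (Complex.Gamma u)⁻¹ = (ascPochhammer ℂ N).eval u * (Complex.Gamma (u + N))⁻¹ := by
  induction N with
  | zero => simp
  | succ N ih =>
    rw [ih, ascPochhammer_succ_eval, Complex.one_div_Gamma_eq_self_mul_one_div_Gamma_add_one]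
    push_cast
    rw [add_assoc]
    ring

/-- The remainder of `f` after subtracting `e^{-t}` times a truncated series. -/
noncomputable def expRemainder (f : ℝ → ℂ) (c : PowerSeries ℂ) (N : ℕ) (t : ℝ) : ℂ :=
  f t - Complex.exp (-t) * (c.trunc N).eval (t : ℂ)

/-- The regularised Mellin transform with `N` terms of the asymptotic series subtracted. -/
noncomputable def regMellin (f : ℝ → ℂ) (c : PowerSeries ℂ) (N : ℕ) (u : ℂ) : ℂ :=
  ∑ k ∈ Finset.range N, PowerSeries.coeff k c * (ascPochhammer ℂ k).eval u +
    (Complex.Gamma u)⁻¹ * mellin (expRemainder f c N) u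

/-- Continuous on `(0, ∞)`, exponentially decaying at infinity, and with `c` as the
asymptotic series of `e^t f` at `0+`. -/
structure MellinRegular (f : ℝ → ℂ) (c : PowerSeries ℂ) : Prop where
  continuousOn : ContinuousOn f (Ioi 0)
  decay : ∃ a > 0, f =O[atTop] fun t : ℝ => Real.exp (-a * t)
  series : HasAsympSeries (fun t : ℝ => Complex.exp t * f t) c

namespace MellinRegular

variable {f : ℝ → ℂ} {c : PowerSeries ℂ}

theorem continuousOn_expRemainder (h : MellinRegular f c) (N : ℕ) :
    ContinuousOn (expRemainder f c N) (Ioi 0) := by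
  refine h.continuousOn.sub (Continuous.continuousOn ?_)
  fun_prop

theorem expRemainder_isBigO_zero (h : MellinRegular f c) (N : ℕ) :
    expRemainder f c N =O[𝓝[>] 0] fun t : ℝ => t ^ (-(-(N : ℝ))) := by
  have hc : Continuous fun t : ℝ => Complex.exp (-(t : ℂ)) := by fun_prop
  have hexp : (fun t : ℝ => Complex.exp (-(t : ℂ))) =O[𝓝[>] 0] fun _ : ℝ => (1 : ℝ) :=
    ((hc.tendsto 0).mono_left nhdsWithin_le_nhds).isBigO_one ℝ
  have := hexp.mul (h.series N)
  refine this.congr (fun t => ?_) fun t => by simp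
  rw [mul_sub, ← mul_assoc, ← Complex.exp_add, neg_add_cancel, Complex.exp_zero, one_mul]
  rfl

theorem expRemainder_isBigO_top (h : MellinRegular f c) (N : ℕ) :
    ∃ a > 0, expRemainder f c N =O[atTop] fun t : ℝ => Real.exp (-a * t) := by
  obtain ⟨a, ha, hfa⟩ := h.decay
  have hmono : ∀ {b d : ℝ}, b ≤ d →
      (fun t : ℝ => Real.exp (-d * t)) =O[atTop] fun t : ℝ => Real.exp (-b * t) := by
    intro b d hbd
    refine Asymptotics.IsBigO.of_bound 1 ?_
    filter_upwards [eventually_ge_atTop 0] with t ht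
    rw [one_mul, Real.norm_of_nonneg (Real.exp_pos _).le, Real.norm_of_nonneg (Real.exp_pos _).le]
    gcongr
  -- The subtracted terms `t^k e^{-t}` are `O(e^{-t/2})`, hence the rate `1/2`.
  refine ⟨min a (1 / 2), by positivity, (hfa.trans (hmono (min_le_left _ _))).sub ?_⟩
  suffices hB : (fun t : ℝ => Complex.exp (-t) * (c.trunc N).eval (t : ℂ)) =O[atTop]
      fun t : ℝ => Real.exp (-(1 / 2) * t) from hB.trans (hmono (min_le_right a (1 / 2)))
  simp_rw [eval_trunc, Finset.mul_sum]
  refine Asymptotics.IsBigO.fun_sum fun k _ => ?_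
  have h1 := (isLittleO_pow_exp_pos_mul_atTop k (b := 1 / 2) (by norm_num)).isBigO
  have h2 : (fun t : ℝ => Complex.exp (-(t : ℂ)) * PowerSeries.coeff k c) =O[atTop]
      fun t : ℝ => Real.exp (-t) := by
    refine Asymptotics.IsBigO.of_bound ‖PowerSeries.coeff k c‖ (Eventually.of_forall fun t => ?_)
    rw [norm_mul, Complex.norm_exp, Real.norm_of_nonneg (Real.exp_pos _).le, mul_comm]
    simp
  have h3 : (fun t : ℝ => (t : ℂ) ^ k) =O[atTop] fun t : ℝ => t ^ k :=
    Asymptotics.IsBigO.of_bound 1 (Eventually.of_forall fun t => by simp)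
  refine (h2.mul (h3.trans h1)).congr (fun t => by ring) fun t => ?_
  rw [← Real.exp_add]
  congr 1
  ring

theorem mellinConvergent_expRemainder (h : MellinRegular f c) (N : ℕ) {u : ℂ}
    (hu : -(N : ℝ) < u.re) : MellinConvergent (expRemainder f c N) u := by
  obtain ⟨a, ha, hf⟩ := h.expRemainder_isBigO_top N
  exact mellinConvergent_of_isBigO_rpow_exp ha
    ((h.continuousOn_expRemainder N).locallyIntegrableOn measurableSet_Ioi) hf
    (h.expRemainder_isBigO_zero N) hu

theorem differentiableAt_regMellin (h : MellinRegular f c) (N : ℕ) {u : ℂ}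
    (hu : -(N : ℝ) < u.re) : DifferentiableAt ℂ (regMellin f c N) u := by
  obtain ⟨a, ha, hf⟩ := h.expRemainder_isBigO_top N
  have hd : DifferentiableAt ℂ (mellin (expRemainder f c N)) u :=
    mellin_differentiableAt_of_isBigO_rpow_exp ha
    ((h.continuousOn_expRemainder N).locallyIntegrableOn measurableSet_Ioi) hf
    (h.expRemainder_isBigO_zero N) hu
  refine DifferentiableAt.add ?_ ((Complex.differentiable_one_div_Gamma u).mul hd)
  refine DifferentiableAt.fun_sum fun k _ => ?_
  exact ((ascPochhammer ℂ k).differentiable u).const_mul _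

/-- The newly subtracted term `c_N t^N e^{-t}` has transform `c_N Γ(u + N)`. Divided by `Γ(u)`, it
is exactly the polynomial term added to the sum. -/
theorem regMellin_succ (h : MellinRegular f c) (N : ℕ) {u : ℂ} (hu : -(N : ℝ) < u.re) :
    regMellin f c (N + 1) u = regMellin f c N u := by
  have hN : 0 < (u + N).re := by simp; linarith
  have hE : HasMellin (fun t : ℝ => PowerSeries.coeff N c •
      ((t : ℂ) ^ (N : ℂ) • Complex.exp (-1 * (t : ℂ)))) u
      (PowerSeries.coeff N c • Complex.Gamma (u + N)) := by
    have h1 : MellinConvergent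
        (fun t : ℝ => (t : ℂ) ^ (N : ℂ) • Complex.exp (-1 * (t : ℂ))) u :=
      MellinConvergent.cpow_smul.2 (mellinConvergent_cexp_neg_mul hN (by simp))
    have h2 := hasMellin_const_smul h1 (PowerSeries.coeff N c)
    rwa [mellin_cpow_smul, mellin_cexp_neg_mul hN (by simp), Complex.one_cpow, mul_one] at h2
  have hsub := hasMellin_sub (h.mellinConvergent_expRemainder N hu) hE.1
  have hfun : (fun t : ℝ => expRemainder f c N t - PowerSeries.coeff N c •
      ((t : ℂ) ^ (N : ℂ) • Complex.exp (-1 * (t : ℂ)))) = expRemainder f c (N + 1) := by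
    funext t
    simp only [expRemainder, eval_trunc, Finset.sum_range_succ, smul_eq_mul, neg_one_mul,
      Complex.cpow_natCast]
    ring
  rw [hfun, hE.2] at hsub
  have hG : Complex.Gamma (u + N) ≠ 0 := Complex.Gamma_ne_zero_of_re_pos hN
  rw [regMellin, regMellin, hsub.2, Finset.sum_range_succ, mul_sub,
    show (Complex.Gamma u)⁻¹ * (PowerSeries.coeff N c • Complex.Gamma (u + N)) =
      PowerSeries.coeff N c * (ascPochhammer ℂ N).eval u by
      rw [inv_Gamma_eq_ascPochhammer_mul u N, smul_eq_mul]
      field_simp]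
  ring

theorem regMellin_eq (h : MellinRegular f c) {N M : ℕ} (hNM : N ≤ M) {u : ℂ}
    (hu : -(N : ℝ) < u.re) : regMellin f c M u = regMellin f c N u := by
  induction M, hNM using Nat.le_induction with
  | base => rfl
  | succ M hM ih =>
    rw [h.regMellin_succ M (lt_of_le_of_lt _ hu), ih]
    simpa using hM

end MellinRegular

/-- The entire function continuing `Γ(u)⁻¹ ∫₀^∞ t^{u-1} f(t) dt`. -/
noncomputable def entireMellin (f : ℝ → ℂ) (c : PowerSeries ℂ) (u : ℂ) : ℂ :=
  regMellin f c (⌈-u.re⌉₊ + 1) u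

theorem neg_ceil_neg_add_one_lt (x : ℝ) : -((⌈-x⌉₊ + 1 : ℕ) : ℝ) < x := by
  have := Nat.le_ceil (-x)
  push_cast
  linarith

namespace MellinRegular

variable {f : ℝ → ℂ} {c : PowerSeries ℂ}

theorem entireMellin_eq (h : MellinRegular f c) (N : ℕ) {u : ℂ} (hu : -(N : ℝ) < u.re) :
    entireMellin f c u = regMellin f c N u := by
  rcases le_total N (⌈-u.re⌉₊ + 1) with hN | hN
  · exact h.regMellin_eq hN hu
  · exact (h.regMellin_eq hN (neg_ceil_neg_add_one_lt u.re)).symm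

/-- The number of subtracted terms depends on `u`, but near each point it can be frozen because all
admissible choices agree. -/
theorem differentiable_entireMellin (h : MellinRegular f c) :
    Differentiable ℂ (entireMellin f c) := by
  intro u
  have hu := neg_ceil_neg_add_one_lt u.re
  refine (h.differentiableAt_regMellin _ hu).congr_of_eventuallyEq ?_
  filter_upwards [(isOpen_lt continuous_const Complex.continuous_re).mem_nhds hu] with v hv
  exact h.entireMellin_eq _ hv

theorem entireMellin_of_re_pos (h : MellinRegular f c) {u : ℂ} (hu : 0 < u.re) :
    entireMellin f c u = (Complex.Gamma u)⁻¹ * mellin f u := by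
  rw [h.entireMellin_eq 0 (by simpa using hu), regMellin]
  have : expRemainder f c 0 = f := by
    funext t
    simp [expRemainder]
  simp [this]

/-- Since `1/Γ(-3) = 0`, only the sum survives, and the rising factorials of `-3` of orders `0` to
`3` are `1, -3, 6, -6`. -/
theorem entireMellin_neg_three (h : MellinRegular f c) :
    entireMellin f c (-3) = PowerSeries.coeff 0 c - 3 * PowerSeries.coeff 1 c +
      6 * PowerSeries.coeff 2 c - 6 * PowerSeries.coeff 3 c := by
  rw [h.entireMellin_eq 4 (by norm_num), regMellin,
    show Complex.Gamma (-3) = 0 by exact_mod_cast Complex.Gamma_neg_nat_eq_zero 3]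
  simp only [Finset.sum_range_succ, Finset.sum_range_zero, ascPochhammer_succ_eval,
    ascPochhammer_zero, Polynomial.eval_one]
  push_cast
  simp
  ring

end MellinRegular

/-! ### Existence of meromorphic continuations -/

/-- Passing to normal form can change values only where `G` is not in normal form; analyticity on
`U` rules this out there. -/
theorem isMeromorphicContinuation_of_meromorphicOn {U : Set ℂ} {f G : ℂ → ℂ}
    (hG : MeromorphicOn G univ) (ha : ∀ z ∈ U, AnalyticAt ℂ G z) (he : EqOn G f U) :
    IsMeromorphicContinuation U f (toMeromorphicNFOn G univ) := by
  refine ⟨meromorphicNFOn_toMeromorphicNFOn G univ, fun z hz => ?_⟩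
  rw [toMeromorphicNFOn_eq_toMeromorphicNFAt hG (mem_univ z),
    toMeromorphicNFAt_eq_self.2 (ha z hz).meromorphicNFAt, he hz]

section

variable {U : Set ℂ} {f G : ℂ → ℂ}

theorem isMeromorphicContinuation_meromorphicContinuation
    (hG : MeromorphicOn G univ) (ha : ∀ z ∈ U, AnalyticAt ℂ G z) (he : EqOn G f U) :
    IsMeromorphicContinuation U f (meromorphicContinuation U f) := by
  have h : ∃ F, IsMeromorphicContinuation U f F :=
    ⟨_, isMeromorphicContinuation_of_meromorphicOn hG ha he⟩
  rw [meromorphicContinuation, dif_pos h]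
  exact h.choose_spec

theorem meromorphicContinuation_eventuallyEq_nhdsNE (hU : IsOpen U) (hne : U.Nonempty)
    (hG : MeromorphicOn G univ) (ha : ∀ z ∈ U, AnalyticAt ℂ G z) (he : EqOn G f U) (z : ℂ) :
    meromorphicContinuation U f =ᶠ[𝓝[≠] z] G := by
  rw [(isMeromorphicContinuation_meromorphicContinuation hG ha he).unique hU hne
    (isMeromorphicContinuation_of_meromorphicOn hG ha he)]
  exact hG.toMeromorphicNFOn_eq_self_on_nhdsNE (mem_univ z)

/-- The continuation agrees near `z` with every function that is analytic at `z` and agrees with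
a meromorphic representative near, but possibly not at, `z`. -/
theorem meromorphicContinuation_eventuallyEq_nhds (hU : IsOpen U) (hne : U.Nonempty)
    (hG : MeromorphicOn G univ) (ha : ∀ z ∈ U, AnalyticAt ℂ G z) (he : EqOn G f U) {z : ℂ}
    {A : ℂ → ℂ} (hA : AnalyticAt ℂ A z) (hGA : G =ᶠ[𝓝[≠] z] A) :
    meromorphicContinuation U f =ᶠ[𝓝 z] A :=
  (((isMeromorphicContinuation_meromorphicContinuation hG ha he).1
    (mem_univ z)).eventuallyEq_nhdsNE_iff_eventuallyEq_nhds hA.meromorphicNFAt).1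
    ((meromorphicContinuation_eventuallyEq_nhdsNE hU hne hG ha he z).trans hGA)

end

/-! ### Convergence of the Barnes series and its integral representation -/

theorem summable_one_add_rpow {σ : ℝ} (hσ : 1 < σ) :
    Summable fun n : ℕ => (1 + (n : ℝ)) ^ (-σ) := by
  have h := (summable_nat_add_iff 1).2 (Real.summable_nat_rpow.2 (by linarith : -σ < -1))
  refine h.congr fun n => ?_
  push_cast
  rw [add_comm]

/-- The base is at least `c (1 + m + n)`, and `(1 + m)(1 + n) ≤ (1 + m + n)²`. This bounds the
double series by a product of two single series with exponent `σ/2 > 1`. -/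
theorem summable_add_mul_add_mul_rpow {g a b σ : ℝ} (hg : 0 < g) (ha : 0 < a) (hb : 0 < b)
    (hσ : 2 < σ) : Summable fun mn : ℕ × ℕ => (g + mn.1 * a + mn.2 * b) ^ (-σ) := by
  obtain ⟨c, hc, hcg, hca, hcb⟩ : ∃ c > 0, c ≤ g ∧ c ≤ a ∧ c ≤ b :=
    ⟨min g (min a b), by positivity, min_le_left _ _, (min_le_right _ _).trans (min_le_left _ _),
      (min_le_right _ _).trans (min_le_right _ _)⟩
  have hs := (summable_one_add_rpow (by linarith : 1 < σ / 2)).mul_of_nonneg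
    (summable_one_add_rpow (by linarith : 1 < σ / 2)) (fun n => by positivity)
    (fun n => by positivity)
  refine Summable.of_nonneg_of_le (fun mn => by positivity) (fun mn => ?_)
    (hs.mul_left (c ^ (-σ)))
  obtain ⟨m, n⟩ := mn
  have hm : (0 : ℝ) ≤ m := m.cast_nonneg
  have hn : (0 : ℝ) ≤ n := n.cast_nonneg
  have hw : c * (1 + m + n) ≤ g + m * a + n * b := by nlinarith
  have hprod : (1 + (m : ℝ)) * (1 + n) ≤ (1 + m + n) ^ 2 := by nlinarith [mul_nonneg hm hn]
  calc (g + m * a + n * b) ^ (-σ) ≤ (c * (1 + m + n)) ^ (-σ) :=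
        Real.rpow_le_rpow_of_nonpos (by positivity) hw (by linarith)
    _ = c ^ (-σ) * ((1 + m + n) ^ 2) ^ (-(σ / 2)) := by
        rw [Real.mul_rpow hc.le (by positivity), ← Real.rpow_natCast,
          ← Real.rpow_mul (by positivity)]
        congr 2
        push_cast
        ring
    _ ≤ c ^ (-σ) * ((1 + m) * (1 + n)) ^ (-(σ / 2)) := by
        refine mul_le_mul_of_nonneg_left ?_ (by positivity)
        exact Real.rpow_le_rpow_of_nonpos (by positivity) hprod (by linarith)
    _ = _ := by rw [Real.mul_rpow (by positivity) (by positivity)]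

/-- `t² e^{-γt} / ((1 - e^{-αt})(1 - e^{-βt}))`. -/
noncomputable def barnesKernel (γ α β : ℂ) (t : ℝ) : ℂ :=
  (t : ℂ) ^ 2 * Complex.exp (-γ * t) /
    ((1 - Complex.exp (-α * t)) * (1 - Complex.exp (-β * t)))

/-- The asymptotic series of `e^t` times the Barnes kernel. -/
noncomputable def barnesKernelSeries (γ α β : ℂ) : PowerSeries ℂ :=
  PowerSeries.rescale (1 - γ) (PowerSeries.exp ℂ) * (expSubOneDiv (-α))⁻¹ *
    (expSubOneDiv (-β))⁻¹

theorem norm_cexp_neg_mul_lt_one {α : ℂ} (hα : 0 < α.re) {t : ℝ} (ht : 0 < t) :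
    ‖Complex.exp (-α * t)‖ < 1 := by
  rw [Complex.norm_exp, Real.exp_lt_one_iff]
  simpa using mul_pos hα ht

theorem one_sub_cexp_neg_mul_ne_zero {α : ℂ} (hα : 0 < α.re) {t : ℝ} (ht : 0 < t) :
    1 - Complex.exp (-α * t) ≠ 0 := by
  intro h
  have := norm_cexp_neg_mul_lt_one hα ht
  rw [← sub_eq_zero.1 h, norm_one] at this
  exact lt_irrefl _ this

theorem constantCoeff_expSubOneDiv (α : ℂ) :
    PowerSeries.constantCoeff (expSubOneDiv α) = α := by
  rw [← PowerSeries.coeff_zero_eq_constantCoeff_apply]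
  simp [expSubOneDiv]

theorem tendsto_cexp_neg_mul_atTop {α : ℂ} (hα : 0 < α.re) :
    Tendsto (fun t : ℝ => Complex.exp (-α * t)) atTop (𝓝 0) := by
  rw [tendsto_zero_iff_norm_tendsto_zero]
  simp only [Complex.norm_exp]
  refine Real.tendsto_exp_atBot.comp ?_
  simpa using tendsto_id.const_mul_atTop hα

theorem mellinRegular_barnesKernel {γ α β : ℂ} (hγ : 0 < γ.re) (hα : 0 < α.re)
    (hβ : 0 < β.re) : MellinRegular (barnesKernel γ α β) (barnesKernelSeries γ α β) where
  continuousOn := by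
    refine ContinuousOn.div (by fun_prop) (by fun_prop) fun t ht => ?_
    exact mul_ne_zero (one_sub_cexp_neg_mul_ne_zero hα ht) (one_sub_cexp_neg_mul_ne_zero hβ ht)
  decay := by
    refine ⟨γ.re / 2, by positivity, ?_⟩
    have h1 : Tendsto (fun t : ℝ =>
        ((1 - Complex.exp (-α * t)) * (1 - Complex.exp (-β * t)))⁻¹) atTop (𝓝 1) := by
      have := (((tendsto_cexp_neg_mul_atTop hα).const_sub 1).mul
        ((tendsto_cexp_neg_mul_atTop hβ).const_sub 1)).inv₀ (by simp)
      simpa using this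
    have h2 : (fun t : ℝ => (t : ℂ) ^ 2) =O[atTop] fun t : ℝ => Real.exp (γ.re / 2 * t) := by
      refine Asymptotics.IsBigO.trans (g := fun t : ℝ => t ^ 2) ?_
        (isLittleO_pow_exp_pos_mul_atTop 2 (by positivity)).isBigO
      exact Asymptotics.IsBigO.of_bound 1 (Eventually.of_forall fun t => by simp)
    have h3 : (fun t : ℝ => Complex.exp (-γ * t)) =O[atTop] fun t : ℝ => Real.exp (-γ.re * t) :=
      Asymptotics.IsBigO.of_bound 1 (Eventually.of_forall fun t => by simp [Complex.norm_exp])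
    refine ((h2.mul h3).mul (h1.isBigO_one ℝ)).congr (fun t => rfl) fun t => ?_
    rw [mul_one, ← Real.exp_add]
    congr 1
    ring
  series := by
    have hα0 : -α ≠ 0 := neg_ne_zero.2 fun h => by simp [h] at hα
    have hβ0 : -β ≠ 0 := neg_ne_zero.2 fun h => by simp [h] at hβ
    refine (((hasAsympSeries_exp (1 - γ)).mul
      ((hasAsympSeries_expSubOneDiv (-α)).inv (by rwa [constantCoeff_expSubOneDiv]))).mul
      -- The factors `t²` and `e^t` are absorbed as `e^{(1-γ)t}` divided by `(e^{-αt} - 1)/t` and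
      -- `(e^{-βt} - 1)/t`; the two sign changes cancel.
      ((hasAsympSeries_expSubOneDiv (-β)).inv (by rwa [constantCoeff_expSubOneDiv]))).congr ?_
    filter_upwards [self_mem_nhdsWithin] with t ht
    have ht0 : (t : ℂ) ≠ 0 := by exact_mod_cast (mem_Ioi.1 ht).ne'
    have h1 := one_sub_cexp_neg_mul_ne_zero hα ht
    have h2 := one_sub_cexp_neg_mul_ne_zero hβ ht
    have h1' : Complex.exp (-α * t) - 1 ≠ 0 := fun h => h1 (by linear_combination -h)
    have h2' : Complex.exp (-β * t) - 1 ≠ 0 := fun h => h2 (by linear_combination -h)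
    have h3 : Complex.exp ((1 - γ) * t) = Complex.exp t * Complex.exp (-γ * t) := by
      rw [← Complex.exp_add]
      congr 1
      ring
    rw [barnesKernel, h3]
    field_simp
    ring

theorem tsum_cexp_neg_add_mul_add_mul {γ α β : ℂ} (hα : 0 < α.re) (hβ : 0 < β.re) {t : ℝ}
    (ht : 0 < t) :
    ∑' mn : ℕ × ℕ, Complex.exp (-(γ + mn.1 * α + mn.2 * β) * t) =
      Complex.exp (-γ * t) / ((1 - Complex.exp (-α * t)) * (1 - Complex.exp (-β * t))) := by
  have hsum : ∀ {δ : ℂ}, 0 < δ.re → Summable fun n : ℕ => ‖Complex.exp (-δ * t) ^ n‖ := by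
    intro δ hδ
    simp only [norm_pow]
    exact summable_geometric_of_lt_one (norm_nonneg _) (norm_cexp_neg_mul_lt_one hδ ht)
  have h := tsum_mul_tsum_of_summable_norm (hsum hα) (hsum hβ)
  rw [tsum_geometric_of_norm_lt_one (norm_cexp_neg_mul_lt_one hα ht),
    tsum_geometric_of_norm_lt_one (norm_cexp_neg_mul_lt_one hβ ht)] at h
  have hterm : ∀ mn : ℕ × ℕ, Complex.exp (-(γ + mn.1 * α + mn.2 * β) * t) =
      Complex.exp (-γ * t) * (Complex.exp (-α * t) ^ mn.1 * Complex.exp (-β * t) ^ mn.2) := by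
    intro mn
    rw [← Complex.exp_nat_mul, ← Complex.exp_nat_mul, ← Complex.exp_add, ← Complex.exp_add]
    congr 1
    ring
  simp_rw [hterm]
  rw [tsum_mul_left, ← h, div_eq_mul_inv, mul_inv]

/-- Termwise, `Γ(s) w^{-s} = ∫ t^{s-1} e^{-wt} dt`. Sum and integral may be exchanged because the
integrals of the norms are `Γ(Re s) (Re w)^{-Re s}`, summable for `Re s > 2`. -/
theorem hasSum_barnesTerm {γ α β : ℂ} (hγ : 0 < γ.re) (hα : 0 < α.re) (hβ : 0 < β.re) {s : ℂ}
    (hs : 2 < s.re) : HasSum (barnesTerm γ α β s)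
      ((Complex.Gamma s)⁻¹ * mellin (barnesKernel γ α β) (s - 2)) := by
  have hs0 : 0 < s.re := by linarith
  set w : ℕ × ℕ → ℂ := fun mn => γ + mn.1 * α + mn.2 * β with hw
  have hwre : ∀ mn, (w mn).re = γ.re + mn.1 * α.re + mn.2 * β.re := fun mn => by simp [hw]
  have hwpos : ∀ mn, 0 < (w mn).re := fun mn => by rw [hwre]; positivity
  have hnorm : ∀ mn, ∫ t in Ioi (0 : ℝ), ‖(t : ℂ) ^ (s - 1) * Complex.exp (-w mn * t)‖ =
      (w mn).re ^ (-s.re) * Real.Gamma s.re := by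
    intro mn
    rw [setIntegral_congr_fun measurableSet_Ioi
      (fun t ht => norm_cpow_mul_cexp_neg_mul (s := s) (w := w mn) ht)]
    simp only [neg_mul]
    rw [Real.integral_rpow_mul_exp_neg_mul_Ioi hs0 (hwpos mn), one_div,
      Real.inv_rpow (hwpos mn).le, Real.rpow_neg (hwpos mn).le]
  have h := hasSum_integral_of_summable_integral_norm (μ := volume.restrict (Ioi (0 : ℝ)))
    (F := fun mn t => (t : ℂ) ^ (s - 1) * Complex.exp (-w mn * t))
    (fun mn => integrableOn_cpow_mul_cexp_neg_mul hs0 (hwpos mn)) (by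
      simp only [hnorm, hwre]
      exact (summable_add_mul_add_mul_rpow hγ hα hβ hs).mul_right _)
  have hint : ∫ t in Ioi (0 : ℝ), ∑' mn, (t : ℂ) ^ (s - 1) * Complex.exp (-w mn * t) =
      mellin (barnesKernel γ α β) (s - 2) := by
    refine setIntegral_congr_fun measurableSet_Ioi fun t ht => ?_
    have ht0 : (t : ℂ) ≠ 0 := by exact_mod_cast (mem_Ioi.1 ht).ne'
    simp only [hw]
    rw [tsum_mul_left, tsum_cexp_neg_add_mul_add_mul hα hβ ht, barnesKernel,
      show s - 1 = (s - 2 - 1) + (2 : ℕ) by push_cast; ring, Complex.cpow_add _ _ ht0,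
      Complex.cpow_natCast, smul_eq_mul]
    ring
  rw [hint] at h
  refine (h.mul_left (Complex.Gamma s)⁻¹).congr_fun fun mn => ?_
  have := mellin_cexp_neg_mul hs0 (hwpos mn)
  simp only [mellin, smul_eq_mul] at this
  rw [this, inv_mul_cancel_left₀ (Complex.Gamma_ne_zero_of_re_pos hs0), barnesTerm,
    Complex.cpow_neg, one_div]

/-! ### The Barnes zeta function -/

/-- The entire numerator of the Barnes zeta function, shifted by two. -/
noncomputable def barnesEntire (γ α β : ℂ) : ℂ → ℂ :=
  entireMellin (barnesKernel γ α β) (barnesKernelSeries γ α β)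

/-- Exchanges `Γ(s)` for the factor `Γ(s - 2)` that normalises the transform at `s - 2`; the linear
factors are the only source of poles. -/
theorem Gamma_eq_mul_Gamma_sub_two {s : ℂ} (h1 : s ≠ 1) (h2 : s ≠ 2) :
    Complex.Gamma s = (s - 1) * (s - 2) * Complex.Gamma (s - 2) := by
  have e1 := Complex.Gamma_add_one (s - 1) (sub_ne_zero.2 h1)
  have e2 := Complex.Gamma_add_one (s - 2) (sub_ne_zero.2 h2)
  rw [sub_add_cancel] at e1
  rw [show s - 2 + 1 = s - 1 by ring] at e2
  rw [e1, e2, mul_assoc]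

section

variable {γ α β : ℂ}

theorem differentiable_barnesEntire (hγ : 0 < γ.re) (hα : 0 < α.re) (hβ : 0 < β.re) :
    Differentiable ℂ (barnesEntire γ α β) :=
  (mellinRegular_barnesKernel hγ hα hβ).differentiable_entireMellin

theorem analyticAt_barnesEntire_div (hγ : 0 < γ.re) (hα : 0 < α.re) (hβ : 0 < β.re) {s : ℂ}
    (h1 : s ≠ 1) (h2 : s ≠ 2) :
    AnalyticAt ℂ (fun s => barnesEntire γ α β (s - 2) / ((s - 1) * (s - 2))) s := by
  have hd : Differentiable ℂ fun s => barnesEntire γ α β (s - 2) :=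
    (differentiable_barnesEntire hγ hα hβ).comp (differentiable_id.sub_const 2)
  refine (hd.analyticAt s).div (by fun_prop) ?_
  exact mul_ne_zero (sub_ne_zero.2 h1) (sub_ne_zero.2 h2)

theorem meromorphicOn_barnesEntire_div (hγ : 0 < γ.re) (hα : 0 < α.re) (hβ : 0 < β.re) :
    MeromorphicOn (fun s => barnesEntire γ α β (s - 2) / ((s - 1) * (s - 2))) univ := by
  intro s _
  have hd : Differentiable ℂ fun s => barnesEntire γ α β (s - 2) :=
    (differentiable_barnesEntire hγ hα hβ).comp (differentiable_id.sub_const 2)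
  have ha : AnalyticAt ℂ (fun s : ℂ => (s - 1) * (s - 2)) s := by fun_prop
  exact (hd.analyticAt s).meromorphicAt.div ha.meromorphicAt

theorem barnesEntire_div_eqOn_barnesSeries (hγ : 0 < γ.re) (hα : 0 < α.re) (hβ : 0 < β.re) :
    EqOn (fun s => barnesEntire γ α β (s - 2) / ((s - 1) * (s - 2))) (barnesSeries γ α β)
      {s | 2 < s.re} := by
  intro s hs
  have hs' : 2 < s.re := hs
  have hs2 : 0 < (s - 2).re := by simp; linarith
  have h1 : s ≠ 1 := by rintro rfl; norm_num at hs'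
  have h2 : s ≠ 2 := by rintro rfl; norm_num at hs'
  simp only
  rw [barnesSeries, (hasSum_barnesTerm hγ hα hβ hs').tsum_eq, barnesEntire,
    (mellinRegular_barnesKernel hγ hα hβ).entireMellin_of_re_pos hs2,
    Gamma_eq_mul_Gamma_sub_two h1 h2, mul_inv]
  ring

theorem ne_one_and_ne_two_of_two_lt_re {s : ℂ} (hs : 2 < s.re) : s ≠ 1 ∧ s ≠ 2 := by
  constructor <;> rintro rfl <;> norm_num at hs

theorem isOpen_two_lt_re : IsOpen {s : ℂ | 2 < s.re} :=
  isOpen_lt continuous_const Complex.continuous_re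

theorem isMeromorphicContinuation_barnesZeta (hγ : 0 < γ.re) (hα : 0 < α.re)
    (hβ : 0 < β.re) :
    IsMeromorphicContinuation {s : ℂ | 2 < s.re} (barnesSeries γ α β) (barnesZeta γ α β) :=
  isMeromorphicContinuation_meromorphicContinuation
    (meromorphicOn_barnesEntire_div hγ hα hβ)
    (fun _ hs => analyticAt_barnesEntire_div hγ hα hβ (ne_one_and_ne_two_of_two_lt_re hs).1
      (ne_one_and_ne_two_of_two_lt_re hs).2)
    (barnesEntire_div_eqOn_barnesSeries hγ hα hβ)

theorem barnesZeta_eventuallyEq (hγ : 0 < γ.re) (hα : 0 < α.re) (hβ : 0 < β.re) {s : ℂ}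
    (h1 : s ≠ 1) (h2 : s ≠ 2) : barnesZeta γ α β =ᶠ[𝓝 s]
      fun s => barnesEntire γ α β (s - 2) / ((s - 1) * (s - 2)) :=
  meromorphicContinuation_eventuallyEq_nhds isOpen_two_lt_re ⟨3, by norm_num⟩
    (meromorphicOn_barnesEntire_div hγ hα hβ)
    (fun _ hs => analyticAt_barnesEntire_div hγ hα hβ (ne_one_and_ne_two_of_two_lt_re hs).1
      (ne_one_and_ne_two_of_two_lt_re hs).2)
    (barnesEntire_div_eqOn_barnesSeries hγ hα hβ) (analyticAt_barnesEntire_div hγ hα hβ h1 h2)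
    EventuallyEq.rfl

theorem barnesZeta_eq (hγ : 0 < γ.re) (hα : 0 < α.re) (hβ : 0 < β.re) {s : ℂ}
    (h1 : s ≠ 1) (h2 : s ≠ 2) :
    barnesZeta γ α β s = barnesEntire γ α β (s - 2) / ((s - 1) * (s - 2)) :=
  (barnesZeta_eventuallyEq hγ hα hβ h1 h2).eq_of_nhds

theorem analyticAt_barnesZeta (hγ : 0 < γ.re) (hα : 0 < α.re) (hβ : 0 < β.re) {s : ℂ}
    (h1 : s ≠ 1) (h2 : s ≠ 2) : AnalyticAt ℂ (barnesZeta γ α β) s :=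
  (analyticAt_barnesEntire_div hγ hα hβ h1 h2).congr (barnesZeta_eventuallyEq hγ hα hβ h1 h2).symm

end

/-! ### Values of generalised Bernoulli polynomials -/

/-- Comparing coefficients in `q · expSubOneDiv α = 1` gives a triangular system, solved here one
coefficient at a time. -/
theorem coeff_inv_expSubOneDiv {α : ℂ} (hα : α ≠ 0) :
    PowerSeries.coeff 0 (expSubOneDiv α)⁻¹ = α⁻¹ ∧
    PowerSeries.coeff 1 (expSubOneDiv α)⁻¹ = -1 / 2 ∧
    PowerSeries.coeff 2 (expSubOneDiv α)⁻¹ = α / 12 ∧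
    PowerSeries.coeff 3 (expSubOneDiv α)⁻¹ = 0 := by
  have h := PowerSeries.inv_mul_cancel (expSubOneDiv α) (by rwa [constantCoeff_expSubOneDiv])
  generalize (expSubOneDiv α)⁻¹ = q at h ⊢
  have hc : ∀ n, PowerSeries.coeff n (q * expSubOneDiv α) =
      PowerSeries.coeff n (1 : PowerSeries ℂ) := fun n => by rw [h]
  have h0 := hc 0
  have h1 := hc 1
  have h2 := hc 2
  have h3 := hc 3
  simp only [PowerSeries.coeff_mul, Finset.Nat.sum_antidiagonal_eq_sum_range_succ_mk,
    Finset.sum_range_succ, Finset.sum_range_zero, expSubOneDiv, PowerSeries.coeff_mk,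
    PowerSeries.coeff_one, Nat.factorial] at h0 h1 h2 h3
  norm_num only at h0 h1 h2 h3
  simp only [pow_one, div_one, ite_true, ite_false] at h0 h1 h2 h3
  have e0 : PowerSeries.coeff 0 q = α⁻¹ := by
    field_simp
    linear_combination h0
  rw [e0] at h1 h2 h3
  field_simp at h1 h2 h3
  have e1 : PowerSeries.coeff 1 q = -1 / 2 :=
    mul_left_cancel₀ hα (by linear_combination h1 / 2)
  rw [e1] at h2 h3
  have e2 : PowerSeries.coeff 2 q = α / 12 :=
    mul_left_cancel₀ hα (by linear_combination h2 / 12)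
  rw [e2] at h3
  have e3 : PowerSeries.coeff 3 q = 0 :=
    mul_left_cancel₀ hα (by linear_combination h3 / 288)
  exact ⟨e0, e1, e2, e3⟩

theorem genBernoulli_three {γ α β : ℂ} (hα : α ≠ 0) (hβ : β ≠ 0) :
    genBernoulli 3 γ α β = 1 / 4 * (2 * γ - α - β) * (2 * γ * (γ - α - β) + α * β) := by
  obtain ⟨a0, a1, a2, a3⟩ := coeff_inv_expSubOneDiv hα
  obtain ⟨b0, b1, b2, b3⟩ := coeff_inv_expSubOneDiv hβ
  rw [genBernoulli, mul_assoc, mul_assoc, PowerSeries.coeff_C_mul]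
  simp only [PowerSeries.coeff_mul, Finset.Nat.sum_antidiagonal_eq_sum_range_succ_mk,
    Finset.sum_range_succ, Finset.sum_range_zero, Nat.sub_zero, Nat.reduceSub, Nat.sub_self,
    PowerSeries.coeff_rescale, PowerSeries.coeff_exp, a0, a1, a2, a3, b0, b1, b2, b3]
  norm_num [Nat.factorial]
  field_simp
  ring

theorem barnesEntire_neg_three {γ α β : ℂ} (hγ : 0 < γ.re) (hα : 0 < α.re) (hβ : 0 < β.re) :
    barnesEntire γ α β (-3) =
      1 / (4 * α * β) * (2 * γ - α - β) * (2 * γ * (γ - α - β) + α * β) := by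
  have hα0 : α ≠ 0 := fun h => by simp [h] at hα
  have hβ0 : β ≠ 0 := fun h => by simp [h] at hβ
  obtain ⟨a0, a1, a2, a3⟩ := coeff_inv_expSubOneDiv (neg_ne_zero.2 hα0)
  obtain ⟨b0, b1, b2, b3⟩ := coeff_inv_expSubOneDiv (neg_ne_zero.2 hβ0)
  rw [barnesEntire, (mellinRegular_barnesKernel hγ hα hβ).entireMellin_neg_three,
    barnesKernelSeries]
  simp only [PowerSeries.coeff_mul, Finset.Nat.sum_antidiagonal_eq_sum_range_succ_mk,
    Finset.sum_range_succ, Finset.sum_range_zero, Nat.sub_zero, Nat.reduceSub, Nat.sub_self,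
    PowerSeries.coeff_rescale, PowerSeries.coeff_exp, a0, a1, a2, a3, b0, b1, b2, b3]
  norm_num [Nat.factorial]
  field_simp
  ring

theorem barnesZeta_neg_one {γ α β : ℂ} (hγ : 0 < γ.re) (hα : 0 < α.re) (hβ : 0 < β.re) :
    barnesZeta γ α β (-1) =
      1 / (24 * α * β) * (2 * γ - α - β) * (2 * γ * (γ - α - β) + α * β) := by
  have hα0 : α ≠ 0 := fun h => by simp [h] at hα
  have hβ0 : β ≠ 0 := fun h => by simp [h] at hβ
  rw [barnesZeta_eq hγ hα hβ (by norm_num) (by norm_num), show (-1 : ℂ) - 2 = -3 by norm_num,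
    barnesEntire_neg_three hγ hα hβ]
  field_simp
  ring

/-! ### The elliptic bracket as a combination of Barnes kernels -/

/-- The combination of Barnes kernels that represents the elliptic bracket. -/
noncomputable def ellipticKernel (p : ℕ) (t : ℝ) : ℂ :=
  barnesKernel 1 2 p t + barnesKernel (1 + p) 2 p t - 1 / p * barnesKernel 1 1 1 t

/-- The entire function `Γ(u)⁻¹ ∫₀^∞ t^{u-1} ellipticKernel p t dt`. -/
noncomputable def ellipticEntire (p : ℕ) (u : ℂ) : ℂ :=
  barnesEntire 1 2 p u + barnesEntire (1 + p) 2 p u - 1 / p * barnesEntire 1 1 1 u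

/-- These two coefficients suffice to see that the elliptic combination vanishes to second order at
`0`. -/
theorem coeff_barnesKernelSeries {γ α β : ℂ} (hα : α ≠ 0) (hβ : β ≠ 0) :
    PowerSeries.coeff 0 (barnesKernelSeries γ α β) = 1 / (α * β) ∧
    PowerSeries.coeff 1 (barnesKernelSeries γ α β) = (1 - γ + (α + β) / 2) / (α * β) := by
  obtain ⟨a0, a1, -, -⟩ := coeff_inv_expSubOneDiv (neg_ne_zero.2 hα)
  obtain ⟨b0, b1, -, -⟩ := coeff_inv_expSubOneDiv (neg_ne_zero.2 hβ)
  rw [barnesKernelSeries]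
  simp only [PowerSeries.coeff_mul, Finset.Nat.sum_antidiagonal_eq_sum_range_succ_mk,
    Finset.sum_range_succ, Finset.sum_range_zero, Nat.sub_zero, Nat.sub_self,
    PowerSeries.coeff_rescale, PowerSeries.coeff_exp, a0, a1, b0, b1]
  norm_num [Nat.factorial]
  constructor <;> field_simp
  ring

section

variable {p : ℕ}

theorem re_natCast_pos (hp : 2 ≤ p) : 0 < (p : ℂ).re := by
  rw [Complex.natCast_re]
  exact_mod_cast (by omega : 0 < p)

theorem re_one_add_natCast_pos (p : ℕ) : 0 < (1 + (p : ℂ)).re := by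
  rw [Complex.add_re, Complex.natCast_re, Complex.one_re]
  positivity

/-- The subtracted terms cancel: the constant coefficients add up to `1/(2p) + 1/(2p) - 1/p = 0`,
and the linear ones to `(2 + p)/(4p) + (2 - p)/(4p) - 1/p = 0`. Hence the transform of the
combination converges already for `Re u > -2`, without regularisation. -/
theorem ellipticKernel_eq_expRemainder (hp : 2 ≤ p) (t : ℝ) :
    ellipticKernel p t =
      expRemainder (barnesKernel 1 2 p) (barnesKernelSeries 1 2 p) 2 t +
      expRemainder (barnesKernel (1 + p) 2 p) (barnesKernelSeries (1 + p) 2 p) 2 t -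
      (1 / p : ℂ) • expRemainder (barnesKernel 1 1 1) (barnesKernelSeries 1 1 1) 2 t := by
  have hp0 : (p : ℂ) ≠ 0 := by exact_mod_cast (by omega : p ≠ 0)
  obtain ⟨a0, a1⟩ := coeff_barnesKernelSeries (γ := 1) two_ne_zero hp0
  obtain ⟨b0, b1⟩ := coeff_barnesKernelSeries (γ := 1 + p) two_ne_zero hp0
  obtain ⟨c0, c1⟩ := coeff_barnesKernelSeries (γ := 1) (α := 1) (β := 1) one_ne_zero one_ne_zero
  simp only [expRemainder, eval_trunc, Finset.sum_range_succ, Finset.sum_range_zero, a0, a1, b0,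
    b1, c0, c1, ellipticKernel, smul_eq_mul]
  field_simp
  ring

theorem hasMellin_ellipticKernel (hp : 2 ≤ p) {u : ℂ} (hu : -2 < u.re) :
    HasMellin (ellipticKernel p) u
      (mellin (expRemainder (barnesKernel 1 2 p) (barnesKernelSeries 1 2 p) 2) u +
      mellin (expRemainder (barnesKernel (1 + p) 2 p) (barnesKernelSeries (1 + p) 2 p) 2) u -
      (1 / p : ℂ) •
        mellin (expRemainder (barnesKernel 1 1 1) (barnesKernelSeries 1 1 1) 2) u) := by
  have hpre := re_natCast_pos hp
  have h1 := (mellinRegular_barnesKernel (γ := 1) (α := 2) (by simp) (by simp)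
    hpre).mellinConvergent_expRemainder 2 (u := u) (by simpa using hu)
  have h2 := (mellinRegular_barnesKernel (α := 2) (re_one_add_natCast_pos p) (by simp)
    hpre).mellinConvergent_expRemainder 2 (u := u) (by simpa using hu)
  have h3 := (mellinRegular_barnesKernel (γ := 1) (α := 1) (β := 1) (by simp) (by simp)
    (by simp)).mellinConvergent_expRemainder 2 (u := u) (by simpa using hu)
  have h12 := hasMellin_add h1 h2
  have h3' := hasMellin_const_smul h3 (1 / p : ℂ)
  have h := hasMellin_sub h12.1 h3'.1
  rw [h12.2, h3'.2] at h
  rwa [show ellipticKernel p = _ from funext (ellipticKernel_eq_expRemainder hp)]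

theorem ellipticEntire_eq (hp : 2 ≤ p) {u : ℂ} (hu : -2 < u.re) :
    ellipticEntire p u = (Complex.Gamma u)⁻¹ * mellin (ellipticKernel p) u := by
  have hpre := re_natCast_pos hp
  have hp0 : (p : ℂ) ≠ 0 := by exact_mod_cast (by omega : p ≠ 0)
  have hu' : -((2 : ℕ) : ℝ) < u.re := by simpa using hu
  obtain ⟨a0, a1⟩ := coeff_barnesKernelSeries (γ := 1) two_ne_zero hp0
  obtain ⟨b0, b1⟩ := coeff_barnesKernelSeries (γ := 1 + p) two_ne_zero hp0
  obtain ⟨c0, c1⟩ := coeff_barnesKernelSeries (γ := 1) (α := 1) (β := 1) one_ne_zero one_ne_zero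
  rw [(hasMellin_ellipticKernel hp hu).2, ellipticEntire, barnesEntire, barnesEntire, barnesEntire,
    (mellinRegular_barnesKernel (by simp) (by simp) hpre).entireMellin_eq 2 hu',
    (mellinRegular_barnesKernel (re_one_add_natCast_pos p) (by simp) hpre).entireMellin_eq 2 hu',
    (mellinRegular_barnesKernel (by simp) (by simp) (by simp)).entireMellin_eq 2 hu']
  simp only [regMellin, Finset.sum_range_succ, Finset.sum_range_zero, a0, a1, b0, b1, c0, c1,
    smul_eq_mul]
  field_simp
  ring

theorem differentiable_ellipticEntire (hp : 2 ≤ p) : Differentiable ℂ (ellipticEntire p) := by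
  have hpre := re_natCast_pos hp
  exact ((differentiable_barnesEntire (by simp) (by simp) hpre).add
    (differentiable_barnesEntire (re_one_add_natCast_pos p) (by simp) hpre)).sub
    ((differentiable_barnesEntire (by simp) (by simp) (by simp)).const_mul _)

theorem ellipticBracket_eq (hp : 2 ≤ p) {x : ℝ} (hx : 0 < x) :
    (ellipticBracket p x : ℂ) =
      2 * (((2 * x : ℝ) : ℂ) ^ (-2 : ℂ) • ellipticKernel p (2 * x)) := by
  have hp0 : (p : ℂ) ≠ 0 := by exact_mod_cast (by omega : p ≠ 0)
  have hx0 : (x : ℂ) ≠ 0 := by exact_mod_cast hx.ne'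
  have hx2 : 0 < 2 * x := by positivity
  have h1 := one_sub_cexp_neg_mul_ne_zero (α := 1) (by simp) hx2
  have h2 := one_sub_cexp_neg_mul_ne_zero (α := 2) (by simp) hx2
  have hP := one_sub_cexp_neg_mul_ne_zero (re_natCast_pos hp) hx2
  -- In terms of `A = e^{-x}` and `P = e^{-px}` both sides are rational: `coth px = (1 + P²)/(1 -
  -- P²)` and `1/sinh 2x = 2A²/(1 - A⁴)`. The summands `1` and `P²` of the numerator give `γ = 1`
  -- and `γ = 1 + p`.
  set A := Complex.exp (-x) with hA
  set P := Complex.exp (-(p * x)) with hPdef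
  have hA0 : A ≠ 0 := Complex.exp_ne_zero _
  have hP0 : P ≠ 0 := Complex.exp_ne_zero _
  have e1 : Complex.exp (-1 * ((2 * x : ℝ) : ℂ)) = A ^ 2 := by
    rw [hA, ← Complex.exp_nat_mul]
    push_cast
    ring_nf
  have e2 : Complex.exp (-2 * ((2 * x : ℝ) : ℂ)) = A ^ 4 := by
    rw [hA, ← Complex.exp_nat_mul]
    push_cast
    ring_nf
  have e3 : Complex.exp (-(p : ℂ) * ((2 * x : ℝ) : ℂ)) = P ^ 2 := by
    rw [hPdef, ← Complex.exp_nat_mul]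
    push_cast
    ring_nf
  have e4 : Complex.exp (-(1 + (p : ℂ)) * ((2 * x : ℝ) : ℂ)) = A ^ 2 * P ^ 2 := by
    rw [← e1, ← e3, ← Complex.exp_add]
    ring_nf
  have f1 : Complex.exp x = A⁻¹ := by rw [hA, Complex.exp_neg, inv_inv]
  have f2 : Complex.exp (p * x) = P⁻¹ := by rw [hPdef, Complex.exp_neg, inv_inv]
  have f3 : Complex.exp (2 * x) = (A ^ 2)⁻¹ := by
    rw [← e1, ← Complex.exp_neg]
    push_cast
    ring_nf
  have f4 : Complex.exp (-(2 * x)) = A ^ 2 := by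
    rw [← e1]
    push_cast
    ring_nf
  rw [e1] at h1
  rw [e2] at h2
  rw [e3] at hP
  have hcpow : ((2 * x : ℝ) : ℂ) ^ (-2 : ℂ) = (((2 * x : ℝ) : ℂ) ^ 2)⁻¹ := by
    rw [Complex.cpow_neg]
    norm_cast
  rw [hcpow, ellipticKernel, barnesKernel, barnesKernel, barnesKernel, e1, e2, e3, e4,
    ellipticBracket]
  push_cast
  rw [Complex.cosh, Complex.sinh, Complex.sinh, Complex.sinh, f1, f2, f3, f4, ← hA, ← hPdef]
  have h4 : 1 - A ^ 4 = (1 - A ^ 2) * (1 + A ^ 2) := by ring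
  rw [h4] at h2 ⊢
  have h5 : 1 + A ^ 2 ≠ 0 := right_ne_zero_of_mul h2
  have k1 : A⁻¹ - A = (1 - A ^ 2) / A := by field_simp
  have k2 : P⁻¹ - P = (1 - P ^ 2) / P := by field_simp
  have k3 : (A ^ 2)⁻¹ - A ^ 2 = (1 - A ^ 2) * (1 + A ^ 2) / A ^ 2 := by
    field_simp
    ring
  rw [k1, k2, k3]
  rw [smul_eq_mul]
  field_simp

theorem hasMellin_ellipticBracket (hp : 2 ≤ p) {u : ℂ} (hu : 0 < u.re) :
    HasMellin (fun x : ℝ => (ellipticBracket p x : ℂ)) u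
      (2 ^ (1 - u) * mellin (ellipticKernel p) (u - 2)) := by
  have h0 := hasMellin_ellipticKernel hp (u := u + -2) (by simp; linarith)
  have h1 : MellinConvergent (fun t : ℝ => (t : ℂ) ^ (-2 : ℂ) • ellipticKernel p t) u :=
    MellinConvergent.cpow_smul.2 h0.1
  have h2 := (MellinConvergent.comp_mul_left (two_pos (α := ℝ))).2 h1
  have h3 := hasMellin_const_smul h2 (2 : ℂ)
  have hcongr : EqOn
      (fun t : ℝ => (2 : ℂ) • (((2 * t : ℝ) : ℂ) ^ (-2 : ℂ) • ellipticKernel p (2 * t)))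
      (fun x : ℝ => (ellipticBracket p x : ℂ)) (Ioi 0) := fun x hx => by
    simp only [ellipticBracket_eq hp hx, smul_eq_mul]
  have hcongr' : EqOn (fun t : ℝ => (t : ℂ) ^ (u - 1) •
      (2 : ℂ) • (((2 * t : ℝ) : ℂ) ^ (-2 : ℂ) • ellipticKernel p (2 * t)))
      (fun x : ℝ => (x : ℂ) ^ (u - 1) • (ellipticBracket p x : ℂ)) (Ioi 0) := fun x hx => by
    have := hcongr hx
    simp only at this ⊢
    rw [this]
  refine ⟨(integrableOn_congr_fun hcongr' measurableSet_Ioi).1 h3.1, ?_⟩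
  rw [mellin, ← setIntegral_congr_fun measurableSet_Ioi hcongr']
  refine h3.2.trans ?_
  rw [mellin_comp_mul_left (fun t : ℝ => (t : ℂ) ^ (-2 : ℂ) • ellipticKernel p t) u
    (two_pos (α := ℝ)), mellin_cpow_smul, sub_eq_add_neg 1 u,
    Complex.cpow_add _ _ two_ne_zero, Complex.cpow_one, sub_eq_add_neg u 2]
  simp only [smul_eq_mul, Complex.ofReal_ofNat]
  ring

end

/-! ### The Mellin transform of the heat kernel -/

/-- The integrand `t^{s-3/2} e^{-x²/t}`. -/
noncomputable def heatIntegrand (s : ℂ) (x t : ℝ) : ℂ :=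
  (t : ℂ) ^ (s - 1 / 2 - 1) * Complex.exp (-((x ^ 2 : ℝ) : ℂ) * (t⁻¹ : ℝ))

/-- Taking norms replaces `s` by its real part, so the complex integral formula also evaluates the
integral of the norm needed for Fubini. -/
theorem norm_heatIntegrand (s : ℂ) (x : ℝ) {t : ℝ} (ht : 0 < t) :
    (‖heatIntegrand s x t‖ : ℂ) = heatIntegrand s.re x t := by
  rw [heatIntegrand, norm_mul, Complex.norm_cpow_eq_rpow_re_of_pos ht, Complex.norm_exp,
    heatIntegrand, Complex.ofReal_mul, Complex.ofReal_cpow ht.le, Complex.ofReal_exp]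
  congr 2
  · simp
  · rw [← Complex.ofReal_neg, ← Complex.ofReal_mul, Complex.ofReal_re]

/-- The substitution `t ↦ 1/t` sends `s` to `-s` and reduces this to the Gamma integral. -/
theorem hasMellin_cexp_neg_mul_inv {s w : ℂ} (hs : s.re < 0) (hw : 0 < w.re) :
    HasMellin (fun t : ℝ => Complex.exp (-w * (t⁻¹ : ℝ))) s
      (Complex.Gamma (-s) * w ^ s) := by
  have hs' : 0 < (-s).re := by simpa using hs
  constructor
  · have h := (MellinConvergent.comp_rpow (f := fun t : ℝ => Complex.exp (-w * (t : ℂ))) (s := s)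
      (a := -1) (by norm_num)).2
      (by simpa [div_neg] using mellinConvergent_cexp_neg_mul hs' hw)
    simpa only [Real.rpow_neg_one] using h
  · rw [mellin_comp_inv (fun t : ℝ => Complex.exp (-w * (t : ℂ))),
      mellin_cexp_neg_mul hs' hw, neg_neg]

theorem integrableOn_heatIntegrand {s : ℂ} (hs : s.re < 1 / 2) {x : ℝ} (hx : 0 < x) :
    IntegrableOn (heatIntegrand s x) (Ioi 0) :=
  (hasMellin_cexp_neg_mul_inv (s := s - 1 / 2) (w := ((x ^ 2 : ℝ) : ℂ))
    (by simp; linarith) (by rw [Complex.ofReal_re]; positivity)).1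

theorem integral_heatIntegrand {s : ℂ} (hs : s.re < 1 / 2) {x : ℝ} (hx : 0 < x) :
    ∫ t in Ioi (0 : ℝ), heatIntegrand s x t =
      Complex.Gamma (1 / 2 - s) * (x : ℂ) ^ (2 * s - 1) := by
  have h := (hasMellin_cexp_neg_mul_inv (s := s - 1 / 2) (w := ((x ^ 2 : ℝ) : ℂ))
    (by simp; linarith) (by rw [Complex.ofReal_re]; positivity)).2
  have hpow : ((x ^ 2 : ℝ) : ℂ) ^ (s - 1 / 2) = (x : ℂ) ^ (2 * s - 1) := by
    have hx0 : (x : ℂ) ≠ 0 := by exact_mod_cast hx.ne'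
    rw [sq, Complex.ofReal_mul, Complex.mul_cpow_ofReal_nonneg hx.le hx.le,
      ← Complex.cpow_add _ _ hx0]
    congr 1
    ring
  rw [neg_sub, hpow] at h
  exact h

theorem integral_norm_heatIntegrand {s : ℂ} (hs : s.re < 1 / 2) {x : ℝ} (hx : 0 < x) :
    ∫ t in Ioi (0 : ℝ), ‖heatIntegrand s x t‖ =
      Real.Gamma (1 / 2 - s.re) * x ^ (2 * s.re - 1) := by
  apply Complex.ofReal_injective
  rw [← integral_complex_ofReal, setIntegral_congr_fun measurableSet_Ioi
    (fun t ht => norm_heatIntegrand s x ht), integral_heatIntegrand (by simpa using hs) hx]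
  push_cast
  rw [Complex.ofReal_cpow hx.le, ← Complex.Gamma_ofReal]
  push_cast
  rfl

theorem continuousOn_ellipticBracket {p : ℕ} (hp : 2 ≤ p) :
    ContinuousOn (ellipticBracket p) (Ioi 0) := by
  have hp0 : (0 : ℝ) < p := by exact_mod_cast (by omega : 0 < p)
  have hsinh : ∀ {y : ℝ}, 0 < y → Real.sinh y ≠ 0 := fun hy => (Real.sinh_pos_iff.2 hy).ne'
  unfold ellipticBracket
  refine ContinuousOn.sub (ContinuousOn.div (ContinuousOn.div ?_ ?_ ?_) ?_ ?_)
    (ContinuousOn.div ?_ ?_ ?_)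
  · exact (Real.continuous_cosh.comp (continuous_const.mul continuous_id)).continuousOn
  · exact (Real.continuous_sinh.comp (continuous_const.mul continuous_id)).continuousOn
  · exact fun x hx => hsinh (mul_pos hp0 hx)
  · exact (Real.continuous_sinh.comp (continuous_const.mul continuous_id)).continuousOn
  · exact fun x hx => hsinh (mul_pos two_pos hx)
  · fun_prop
  · exact (continuous_const.mul (Real.continuous_sinh.pow 2)).continuousOn
  · exact fun x hx => mul_ne_zero (by positivity) (pow_ne_zero 2 (hsinh hx))

theorem integrableOn_ellipticBracket {p : ℕ} (hp : 2 ≤ p) :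
    IntegrableOn (ellipticBracket p) (Ioi 0) := by
  -- At `u = 1` the Mellin weight is `1`, so convergence of the transform is plain integrability.
  have h := (hasMellin_ellipticBracket hp (u := 1) (by simp)).1
  simp only [MellinConvergent, sub_self, Complex.cpow_zero, one_smul] at h
  exact h.re

theorem integrableOn_exp_mul_ellipticBracket {p : ℕ} (hp : 2 ≤ p) {t : ℝ} (ht : 0 < t) :
    IntegrableOn (fun x : ℝ => Real.exp (-x ^ 2 / t) * ellipticBracket p x) (Ioi 0) := by
  refine (integrableOn_ellipticBracket hp).bdd_mul (c := 1) ?_ ?_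
  · exact Continuous.aestronglyMeasurable (by fun_prop)
  · refine Eventually.of_forall fun x => ?_
    rw [Real.norm_of_nonneg (Real.exp_pos _).le, Real.exp_le_one_iff]
    exact div_nonpos_of_nonpos_of_nonneg (by nlinarith [sq_nonneg x]) ht.le

theorem integrable_heatIntegrand_mul_ellipticBracket {p : ℕ} (hp : 2 ≤ p) {s : ℂ}
    (h0 : 0 < s.re) (h1 : s.re < 1 / 2) :
    Integrable (fun z : ℝ × ℝ => heatIntegrand s z.1 z.2 * (ellipticBracket p z.1 : ℂ))
      ((volume.restrict (Ioi (0 : ℝ))).prod (volume.restrict (Ioi (0 : ℝ)))) := by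
  rw [integrable_prod_iff]
  · constructor
    · filter_upwards [ae_restrict_mem measurableSet_Ioi] with x hx
      exact (integrableOn_heatIntegrand h1 hx).mul_const _
    -- Integrating the norm over `t` leaves `Γ(1/2 - Re s) x^{2 Re s - 1}` times the absolute value
    -- of the bracket, which is integrable by Mellin convergence at `2s`.
    · have h := ((hasMellin_ellipticBracket hp (u := 2 * s) (by simpa using h0)).1.norm).const_mul
        (Real.Gamma (1 / 2 - s.re))
      refine (integrableOn_congr_fun (fun x hx => ?_) measurableSet_Ioi).1 h
      simp only [norm_mul, norm_smul]
      rw [integral_mul_const, integral_norm_heatIntegrand h1 hx,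
        Complex.norm_cpow_eq_rpow_re_of_pos hx, mul_assoc]
      simp
  · rw [Measure.prod_restrict]
    refine ContinuousOn.aestronglyMeasurable ?_ (measurableSet_Ioi.prod measurableSet_Ioi)
    unfold heatIntegrand
    refine ContinuousOn.mul (ContinuousOn.mul ?_ ?_) ?_
    · intro z hz
      exact ((Complex.continuousAt_ofReal_cpow_const z.2 (s - 1 / 2 - 1)
        (Or.inr (mem_Ioi.1 hz.2).ne')).comp continuousAt_snd).continuousWithinAt
    · have hinv : ContinuousOn (fun z : ℝ × ℝ => z.2⁻¹) (Ioi 0 ×ˢ Ioi 0) :=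
        continuousOn_snd.inv₀ fun z hz => (mem_Ioi.1 hz.2).ne'
      fun_prop
    · exact Complex.continuous_ofReal.comp_continuousOn
        ((continuousOn_ellipticBracket hp).comp continuousOn_fst fun z hz => hz.1)

theorem cpow_smul_conformalHeatKernel (p : ℕ) (s : ℂ) {t : ℝ} (ht : 0 < t) :
    (t : ℂ) ^ (s - 1) • conformalHeatKernel p t =
      ((Real.sqrt Real.pi : ℝ) : ℂ)⁻¹ * ∫ x in Ioi (0 : ℝ),
        heatIntegrand s x t * (ellipticBracket p x : ℂ) := by
  have ht0 : (t : ℂ) ≠ 0 := by exact_mod_cast ht.ne'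
  have hreal : Real.exp (t / 4) * ellipticHeatKernel p t =
      (Real.sqrt Real.pi)⁻¹ * t ^ (-(1 / 2) : ℝ) *
        ∫ x in Ioi (0 : ℝ), Real.exp (-x ^ 2 / t) * ellipticBracket p x := by
    have he : Real.exp (t / 4) * Real.exp (-t / 4) = 1 := by
      rw [← Real.exp_add]
      ring_nf
      exact Real.exp_zero
    rw [ellipticHeatKernel, Real.sqrt_mul Real.pi_pos.le, Real.rpow_neg ht.le,
      ← Real.sqrt_eq_rpow, one_div, mul_inv]
    linear_combination ((Real.sqrt Real.pi)⁻¹ * (Real.sqrt t)⁻¹ *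
      ∫ x in Ioi (0 : ℝ), Real.exp (-x ^ 2 / t) * ellipticBracket p x) * he
  rw [conformalHeatKernel, hreal]
  push_cast
  rw [← integral_complex_ofReal, Complex.ofReal_cpow ht.le, smul_eq_mul]
  have hsplit : (t : ℂ) ^ (s - 1 / 2 - 1) = (t : ℂ) ^ (s - 1) * (t : ℂ) ^ ((-(1 / 2) : ℝ) : ℂ) := by
    rw [← Complex.cpow_add _ _ ht0]
    congr 1
    push_cast
    ring
  simp only [heatIntegrand, hsplit, mul_assoc]
  rw [integral_const_mul, integral_const_mul]
  have hint : ∀ x : ℝ, ((Real.exp (-x ^ 2 / t) * ellipticBracket p x : ℝ) : ℂ) =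
      Complex.exp (-((x ^ 2 : ℝ) : ℂ) * (t⁻¹ : ℝ)) * (ellipticBracket p x : ℂ) := by
    intro x
    push_cast
    rw [div_eq_mul_inv]
  simp only [hint]
  ring

theorem hasMellin_conformalHeatKernel {p : ℕ} (hp : 2 ≤ p) {s : ℂ}
    (h0 : 0 < s.re) (h1 : s.re < 1 / 2) :
    HasMellin (conformalHeatKernel p) s (((Real.sqrt Real.pi : ℝ) : ℂ)⁻¹ *
      (Complex.Gamma (1 / 2 - s) *
        (2 ^ (1 - 2 * s) * mellin (ellipticKernel p) (2 * s - 2)))) := by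
  have hF := integrable_heatIntegrand_mul_ellipticBracket hp h0 h1
  have hcongr : EqOn (fun t : ℝ => ((Real.sqrt Real.pi : ℝ) : ℂ)⁻¹ * ∫ x in Ioi (0 : ℝ),
      heatIntegrand s x t * (ellipticBracket p x : ℂ))
      (fun t : ℝ => (t : ℂ) ^ (s - 1) • conformalHeatKernel p t) (Ioi 0) :=
    fun t ht => (cpow_smul_conformalHeatKernel p s ht).symm
  refine ⟨(integrableOn_congr_fun hcongr measurableSet_Ioi).1
    (hF.integral_prod_right.const_mul _), ?_⟩
  rw [mellin, ← setIntegral_congr_fun measurableSet_Ioi hcongr, integral_const_mul]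
  congr 1
  rw [← integral_integral_swap hF,
    ← (hasMellin_ellipticBracket hp (u := 2 * s) (by simpa using h0)).2, mellin,
    ← integral_const_mul]
  refine setIntegral_congr_fun measurableSet_Ioi fun x hx => ?_
  rw [integral_mul_const, integral_heatIntegrand h1 hx, smul_eq_mul, mul_assoc]

/-- Duplication turns `Γ(2s) 2^{1-2s}` into `Γ(s) Γ(s + 1/2) / √π`, and reflection evaluates `Γ(s +
1/2) Γ(1/2 - s)` as `π / cos πs`. Where the cosine vanishes, the conventions for `Γ` at poles and
for division by zero make both sides `0`. -/
theorem inv_Gamma_mul_Gamma_half_sub_mul_Gamma_two_mul {s : ℂ} (h0 : 0 < s.re) :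
    (Complex.Gamma s)⁻¹ * (((Real.sqrt Real.pi : ℝ) : ℂ)⁻¹ * Complex.Gamma (1 / 2 - s) *
      2 ^ (1 - 2 * s)) * Complex.Gamma (2 * s) = 1 / Complex.cos (Real.pi * s) := by
  have hG : Complex.Gamma s ≠ 0 := Complex.Gamma_ne_zero_of_re_pos h0
  have hdup := Complex.Gamma_mul_Gamma_add_half s
  have hrefl := Complex.Gamma_mul_Gamma_one_sub (s + 1 / 2)
  have hsin : Complex.sin (Real.pi * (s + 1 / 2)) = Complex.cos (Real.pi * s) := by
    rw [mul_add, mul_one_div, Complex.sin_add_pi_div_two]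
  rw [hsin, show 1 - (s + 1 / 2) = 1 / 2 - s by ring] at hrefl
  have hpi : ((Real.sqrt Real.pi : ℝ) : ℂ) ≠ 0 := by
    exact_mod_cast (Real.sqrt_pos.2 Real.pi_pos).ne'
  have hpi0 : (Real.pi : ℂ) ≠ 0 := by exact_mod_cast Real.pi_ne_zero
  have hsq : ((Real.sqrt Real.pi : ℝ) : ℂ) * ((Real.sqrt Real.pi : ℝ) : ℂ) = Real.pi := by
    exact_mod_cast Real.mul_self_sqrt Real.pi_pos.le
  have e1 : Complex.Gamma (2 * s) * 2 ^ (1 - 2 * s) =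
      Complex.Gamma s * Complex.Gamma (s + 1 / 2) / ((Real.sqrt Real.pi : ℝ) : ℂ) := by
    rw [hdup]
    field_simp
  calc _ = (Complex.Gamma s)⁻¹ * ((Real.sqrt Real.pi : ℝ) : ℂ)⁻¹ * Complex.Gamma (1 / 2 - s) *
        (Complex.Gamma (2 * s) * 2 ^ (1 - 2 * s)) := by ring
    _ = (((Real.sqrt Real.pi : ℝ) : ℂ) * ((Real.sqrt Real.pi : ℝ) : ℂ))⁻¹ *
        (Complex.Gamma (s + 1 / 2) * Complex.Gamma (1 / 2 - s)) := by
        rw [e1]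
        field_simp
    _ = _ := by
        rw [hsq, hrefl]
        field_simp

/-! ### The elliptic zeta function -/

/-- A meromorphic representative of the elliptic zeta function. -/
noncomputable def ellipticRep (p : ℕ) (s : ℂ) : ℂ :=
  1 / Complex.cos (Real.pi * s) *
    (ellipticEntire p (2 * s - 2) / ((2 * s - 1) * (2 * s - 2)))

theorem two_mul_ne_one_of_cos_ne_zero {s : ℂ} (hs : Complex.cos (Real.pi * s) ≠ 0) :
    2 * s ≠ 1 := by
  intro h
  apply hs
  rw [show (Real.pi : ℂ) * s = Real.pi / 2 by linear_combination (Real.pi / 2 : ℂ) * h,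
    Complex.cos_pi_div_two]

theorem cos_pi_mul_ne_zero_of_mem_ellipticStrip {s : ℂ} (hs : s ∈ ellipticStrip) :
    Complex.cos (Real.pi * s) ≠ 0 := by
  intro h
  obtain ⟨k, hk⟩ := Complex.cos_eq_zero_iff.1 h
  have hpi0 : (Real.pi : ℂ) ≠ 0 := by exact_mod_cast Real.pi_ne_zero
  have hs2 : s = (((2 * k + 1 : ℤ) : ℝ) / 2 : ℝ) := by
    apply mul_left_cancel₀ hpi0
    rw [hk]
    push_cast
    ring
  have hre := congrArg Complex.re hs2
  rw [Complex.ofReal_re] at hre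
  obtain ⟨h1, h2⟩ := hs
  rw [hre] at h1 h2
  have h3 : (0 : ℝ) < ((2 * k + 1 : ℤ) : ℝ) := by linarith
  have h4 : ((2 * k + 1 : ℤ) : ℝ) < 1 := by linarith
  norm_cast at h3 h4
  omega

theorem isOpen_ellipticStrip : IsOpen ellipticStrip :=
  (isOpen_lt continuous_const Complex.continuous_re).inter
    (isOpen_lt Complex.continuous_re continuous_const)

theorem ne_one_of_mem_ellipticStrip {s : ℂ} (hs : s ∈ ellipticStrip) : s ≠ 1 := by
  rintro rfl
  have := hs.2
  norm_num at this

section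

variable {p : ℕ}

theorem analyticAt_ellipticEntire_comp (hp : 2 ≤ p) (s : ℂ) :
    AnalyticAt ℂ (fun s : ℂ => ellipticEntire p (2 * s - 2)) s := by
  have hd : Differentiable ℂ fun s : ℂ => ellipticEntire p (2 * s - 2) :=
    (differentiable_ellipticEntire hp).comp (by fun_prop)
  exact hd.analyticAt s

theorem analyticAt_cos_pi_mul (s : ℂ) :
    AnalyticAt ℂ (fun s : ℂ => Complex.cos (Real.pi * s)) s := by
  have hd : Differentiable ℂ fun s : ℂ => Complex.cos (Real.pi * s) := by fun_prop
  exact hd.analyticAt s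

theorem analyticAt_ellipticRep (hp : 2 ≤ p) {s : ℂ} (h1 : s ≠ 1)
    (hs : Complex.cos (Real.pi * s) ≠ 0) : AnalyticAt ℂ (ellipticRep p) s := by
  refine (analyticAt_const.div (analyticAt_cos_pi_mul s) hs).mul
    ((analyticAt_ellipticEntire_comp hp s).div (by fun_prop) ?_)
  refine mul_ne_zero (sub_ne_zero.2 (two_mul_ne_one_of_cos_ne_zero hs)) fun h => h1 ?_
  linear_combination h / 2

theorem meromorphicOn_ellipticRep (hp : 2 ≤ p) : MeromorphicOn (ellipticRep p) univ := by
  intro s _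
  have ha : AnalyticAt ℂ (fun s : ℂ => (2 * s - 1) * (2 * s - 2)) s := by fun_prop
  exact ((MeromorphicAt.const 1 s).div (analyticAt_cos_pi_mul s).meromorphicAt).mul
    ((analyticAt_ellipticEntire_comp hp s).meromorphicAt.div ha.meromorphicAt)

theorem ellipticRep_eqOn (hp : 2 ≤ p) :
    EqOn (ellipticRep p) (ellipticZetaMellin p) ellipticStrip := by
  intro s hs
  have h0 : 0 < s.re := by linarith [hs.1]
  have h2 : 2 * s ≠ 1 := two_mul_ne_one_of_cos_ne_zero (cos_pi_mul_ne_zero_of_mem_ellipticStrip hs)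
  have h3 : 2 * s ≠ 2 := fun h => ne_one_of_mem_ellipticStrip hs (by linear_combination h / 2)
  have hG : Complex.Gamma (2 * s) ≠ 0 := Complex.Gamma_ne_zero_of_re_pos (by simpa using h0)
  have hrec := Gamma_eq_mul_Gamma_sub_two h2 h3
  have hG2 : Complex.Gamma (2 * s - 2) ≠ 0 := fun h => hG (by rw [hrec, h, mul_zero])
  have h2' : 2 * s - 1 ≠ 0 := sub_ne_zero.2 h2
  have h3' : 2 * s - 2 ≠ 0 := sub_ne_zero.2 h3
  rw [ellipticRep, ellipticZetaMellin, (hasMellin_conformalHeatKernel hp h0 hs.2).2,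
    ← inv_Gamma_mul_Gamma_half_sub_mul_Gamma_two_mul h0,
    ellipticEntire_eq hp (by simpa using h0), hrec]
  -- Only field algebra remains: `(2s - 1)(2s - 2) Γ(2s - 2)` on one side cancels the inverse Gamma
  -- factor and the denominator on the other.
  generalize Complex.Gamma (2 * s - 2) = g at hG2 ⊢
  generalize mellin (ellipticKernel p) (2 * s - 2) = m
  generalize 2 * s - 2 = a at h3' ⊢
  generalize 2 * s - 1 = b at h2' ⊢
  field_simp

theorem isMeromorphicContinuation_ellipticZeta (hp : 2 ≤ p) :
    IsMeromorphicContinuation ellipticStrip (ellipticZetaMellin p) (ellipticZeta p) :=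
  isMeromorphicContinuation_meromorphicContinuation (meromorphicOn_ellipticRep hp)
    (fun _ hs => analyticAt_ellipticRep hp (ne_one_of_mem_ellipticStrip hs)
      (cos_pi_mul_ne_zero_of_mem_ellipticStrip hs)) (ellipticRep_eqOn hp)

theorem ellipticZeta_eventuallyEq (hp : 2 ≤ p) {s : ℂ} {A : ℂ → ℂ} (hA : AnalyticAt ℂ A s)
    (hRA : ellipticRep p =ᶠ[𝓝[≠] s] A) : ellipticZeta p =ᶠ[𝓝 s] A :=
  meromorphicContinuation_eventuallyEq_nhds isOpen_ellipticStrip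
    ⟨((3 / 8 : ℝ) : ℂ), by
      constructor <;> rw [Complex.ofReal_re] <;> norm_num⟩
    (meromorphicOn_ellipticRep hp)
    (fun _ hs => analyticAt_ellipticRep hp (ne_one_of_mem_ellipticStrip hs)
      (cos_pi_mul_ne_zero_of_mem_ellipticStrip hs)) (ellipticRep_eqOn hp) hA hRA

/-- The combination of Barnes zeta functions in the formula for `ζ_p`. -/
noncomputable def barnesCombination (p : ℕ) (u : ℂ) : ℂ :=
  barnesZeta 1 2 p u + barnesZeta (1 + p) 2 p u - 1 / p * barnesZeta 1 1 1 u

theorem barnesCombination_eq (hp : 2 ≤ p) {u : ℂ} (h1 : u ≠ 1) (h2 : u ≠ 2) :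
    barnesCombination p u = ellipticEntire p (u - 2) / ((u - 1) * (u - 2)) := by
  have hpre := re_natCast_pos hp
  rw [barnesCombination, barnesZeta_eq (by simp) (by simp) hpre h1 h2,
    barnesZeta_eq (re_one_add_natCast_pos p) (by simp) hpre h1 h2,
    barnesZeta_eq (by simp) (by simp) (by simp) h1 h2, ellipticEntire]
  ring

theorem hasDerivAt_barnesCombination (hp : 2 ≤ p) {u : ℂ} (h1 : u ≠ 1) (h2 : u ≠ 2) :
    HasDerivAt (barnesCombination p) (deriv (barnesZeta 1 2 p) u +
      deriv (barnesZeta (1 + p) 2 p) u - 1 / p * deriv (barnesZeta 1 1 1) u) u := by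
  have hpre := re_natCast_pos hp
  exact ((analyticAt_barnesZeta (by simp) (by simp) hpre h1
    h2).differentiableAt.hasDerivAt.add (analyticAt_barnesZeta (re_one_add_natCast_pos p)
    (by simp) hpre h1 h2).differentiableAt.hasDerivAt).sub
    ((analyticAt_barnesZeta (by simp) (by simp) (by simp) h1
    h2).differentiableAt.hasDerivAt.const_mul _)

theorem analyticAt_barnesCombination (hp : 2 ≤ p) {u : ℂ} (h1 : u ≠ 1) (h2 : u ≠ 2) :
    AnalyticAt ℂ (barnesCombination p) u := by
  have hpre := re_natCast_pos hp
  exact ((analyticAt_barnesZeta (by simp) (by simp) hpre h1 h2).add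
    (analyticAt_barnesZeta (re_one_add_natCast_pos p) (by simp) hpre h1 h2)).sub
    (analyticAt_const.mul (analyticAt_barnesZeta (by simp) (by simp) (by simp) h1 h2))

theorem ellipticRep_eq_barnesCombination (hp : 2 ≤ p) {s : ℂ} (h1 : 2 * s ≠ 1)
    (h2 : 2 * s ≠ 2) :
    ellipticRep p s = 1 / Complex.cos (Real.pi * s) * barnesCombination p (2 * s) := by
  rw [barnesCombination_eq hp h1 h2, ellipticRep]

theorem ellipticZeta_eq (hp : 2 ≤ p) {s : ℂ} (h1 : s ≠ 1)
    (hs : Complex.cos (Real.pi * s) ≠ 0) :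
    ellipticZeta p s = 1 / Complex.cos (Real.pi * s) * barnesCombination p (2 * s) := by
  rw [(ellipticZeta_eventuallyEq hp (analyticAt_ellipticRep hp h1 hs)
    EventuallyEq.rfl).eq_of_nhds]
  exact ellipticRep_eq_barnesCombination hp (two_mul_ne_one_of_cos_ne_zero hs)
    fun h => h1 (by linear_combination h / 2)

/-! ### Cancellation of the secant pole at `-1/2`. -/

theorem barnesZeta_add_barnesZeta_neg_one (hp : 2 ≤ p) :
    barnesZeta 1 2 p (-1) + barnesZeta (1 + p) 2 p (-1) = 0 := by
  have hpre := re_natCast_pos hp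
  rw [barnesZeta_neg_one (by simp) (by simp) hpre,
    barnesZeta_neg_one (re_one_add_natCast_pos p) (by simp) hpre]
  ring

theorem barnesZeta_one_one_one_neg_one : barnesZeta 1 1 1 (-1) = 0 := by
  rw [barnesZeta_neg_one (by simp) (by simp) (by simp)]
  norm_num

theorem barnesCombination_neg_one (hp : 2 ≤ p) : barnesCombination p (-1) = 0 := by
  rw [barnesCombination, barnesZeta_add_barnesZeta_neg_one hp, barnesZeta_one_one_one_neg_one]
  ring

/-- `ζ_p` is analytic at `-1/2`, with value given by derivatives of Barnes zeta functions. -/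
theorem ellipticZeta_neg_half (hp : 2 ≤ p) :
    AnalyticAt ℂ (ellipticZeta p) (-1 / 2) ∧
    ellipticZeta p (-1 / 2) = 2 / (Real.pi : ℂ) *
      (deriv (barnesZeta 1 2 p) (-1) + deriv (barnesZeta (1 + p) 2 p) (-1)
        - 1 / p * deriv (barnesZeta 1 1 1) (-1)) := by
  have hm : (2 : ℂ) * (-1 / 2) = -1 := by norm_num
  set D := deriv (barnesZeta 1 2 p) (-1) + deriv (barnesZeta (1 + p) 2 p) (-1)
        - 1 / p * deriv (barnesZeta 1 1 1) (-1) with hD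
  set Z : ℂ → ℂ := fun s => barnesCombination p (2 * s) with hZ
  set C : ℂ → ℂ := fun s => Complex.cos (Real.pi * s) with hC
  have hpi0 : (Real.pi : ℂ) ≠ 0 := by exact_mod_cast Real.pi_ne_zero
  have hZa : AnalyticAt ℂ Z (-1 / 2) := by
    refine AnalyticAt.fun_comp (g := barnesCombination p) ?_ (by fun_prop)
    rw [hm]
    exact analyticAt_barnesCombination hp (by norm_num) (by norm_num)
  have hZ0 : Z (-1 / 2) = 0 := by rw [hZ]; simp only [hm, barnesCombination_neg_one hp]
  have harg : (Real.pi : ℂ) * (-1 / 2) = -(Real.pi / 2) := by ring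
  have hC0 : C (-1 / 2) = 0 := by
    simp only [hC, harg, Complex.cos_neg, Complex.cos_pi_div_two]
  have hZd : deriv Z (-1 / 2) = 2 * D := by
    have h1 : HasDerivAt (barnesCombination p) D (2 * (-1 / 2)) := by
      rw [hm]
      exact hasDerivAt_barnesCombination hp (by norm_num) (by norm_num)
    have h2 : HasDerivAt (fun s : ℂ => 2 * s) 2 (-1 / 2) := by
      simpa using (hasDerivAt_id (-1 / 2 : ℂ)).const_mul 2
    have h3 : HasDerivAt Z (D * 2) (-1 / 2) := h1.comp (-1 / 2 : ℂ) h2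
    rw [h3.deriv, mul_comm]
  have hCd : deriv C (-1 / 2) = Real.pi := by
    have h2 : HasDerivAt (fun s : ℂ => (Real.pi : ℂ) * s) Real.pi (-1 / 2) := by
      simpa using (hasDerivAt_id (-1 / 2 : ℂ)).const_mul (Real.pi : ℂ)
    have h3 : HasDerivAt C (-Complex.sin (Real.pi * (-1 / 2)) * Real.pi) (-1 / 2) := h2.ccos
    rw [h3.deriv, harg, Complex.sin_neg, Complex.sin_pi_div_two]
    ring
  have hds : ∀ {f : ℂ → ℂ}, AnalyticAt ℂ f (-1 / 2) → AnalyticAt ℂ (dslope f (-1 / 2)) (-1 / 2) := by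
    intro f hf
    obtain ⟨q, hq⟩ := hf
    exact ⟨_, hq.has_fpower_series_dslope_fslope⟩
  have hCs : dslope C (-1 / 2) (-1 / 2) ≠ 0 := by rwa [dslope_same, hCd]
  -- Numerator and cosine both vanish at `-1/2`, so their quotient equals the quotient of their
  -- difference slopes nearby. That quotient is analytic since the cosine has derivative `π` there,
  -- and its value at the point is `2D/π`.
  have hA : AnalyticAt ℂ (fun s => dslope Z (-1 / 2) s / dslope C (-1 / 2) s) (-1 / 2) :=
    (hds hZa).div (hds (analyticAt_cos_pi_mul _)) hCs
  have heq : ellipticRep p =ᶠ[𝓝[≠] (-1 / 2)]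
      fun s => dslope Z (-1 / 2) s / dslope C (-1 / 2) s := by
    have h1 : ∀ᶠ s : ℂ in 𝓝 (-1 / 2), 2 * s ≠ 1 ∧ 2 * s ≠ 2 := by
      have hc : ContinuousAt (fun s : ℂ => 2 * s) (-1 / 2) := by fun_prop
      exact (hc.eventually_ne (by norm_num)).and (hc.eventually_ne (by norm_num))
    filter_upwards [nhdsWithin_le_nhds h1, self_mem_nhdsWithin] with s hs hne
    have hne' : s - (-1 / 2) ≠ 0 := sub_ne_zero.2 hne
    rw [ellipticRep_eq_barnesCombination hp hs.1 hs.2, dslope_of_ne _ hne, dslope_of_ne _ hne,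
      slope_def_field, slope_def_field, hZ0, hC0, sub_zero, sub_zero,
      div_div_div_cancel_right₀ hne']
    ring
  -- The normal form fills in the removable singularity, so the agreement extends from the punctured
  -- neighbourhood to the point itself.
  have hev := ellipticZeta_eventuallyEq hp hA heq
  refine ⟨hA.congr hev.symm, ?_⟩
  rw [hev.eq_of_nhds, dslope_same, dslope_same, hZd, hCd]
  ring

end

theorem mainTheorem2 :
    -- the Barnes zeta function, its value at -1, and the antisymmetry
    (∀ γ α β : ℂ, 0 < γ.re → 0 < α.re → 0 < β.re →
      (∀ s : ℂ, 2 < s.re → Summable (barnesTerm γ α β s)) ∧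
      IsMeromorphicContinuation {s : ℂ | 2 < s.re} (barnesSeries γ α β) (barnesZeta γ α β) ∧
      (∀ s : ℂ, s ≠ 1 → s ≠ 2 → AnalyticAt ℂ (barnesZeta γ α β) s) ∧
      barnesZeta γ α β (-1) = 1 / (6 * α * β) * genBernoulli 3 γ α β ∧
      barnesZeta γ α β (-1) =
        1 / (24 * α * β) * (2 * γ - α - β) * (2 * γ * (γ - α - β) + α * β) ∧
      genBernoulli 3 γ α β = -genBernoulli 3 (α + β - γ) α β) ∧
    -- the elliptic zeta function
    (∀ p : ℕ, 2 ≤ p →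
      (∀ t : ℝ, 0 < t → MeasureTheory.IntegrableOn
        (fun x : ℝ => Real.exp (-x ^ 2 / t) * ellipticBracket p x) (Set.Ioi 0)) ∧
      (∀ s ∈ ellipticStrip, MellinConvergent (conformalHeatKernel p) s) ∧
      IsMeromorphicContinuation ellipticStrip (ellipticZetaMellin p) (ellipticZeta p) ∧
      (∀ s : ℂ, s ≠ 1 → Complex.cos (Real.pi * s) ≠ 0 →
        ellipticZeta p s = 1 / Complex.cos (Real.pi * s) *
          (barnesZeta 1 2 p (2 * s) + barnesZeta (1 + p) 2 p (2 * s)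
            - 1 / p * barnesZeta 1 1 1 (2 * s))) ∧
      -- the residue at s = -1/2 vanishes
      barnesZeta 1 2 p (-1) + barnesZeta (1 + p) 2 p (-1) = 0 ∧
      barnesZeta 1 1 1 (-1) = 0 ∧
      Filter.Tendsto (fun s : ℂ => (s + 1 / 2) * ellipticZeta p s)
        (nhdsWithin (-1 / 2) {(-1 / 2 : ℂ)}ᶜ) (nhds 0) ∧
      -- the value at s = -1/2 is finite and given by derivatives of Barnes zeta functions
      AnalyticAt ℂ (ellipticZeta p) (-1 / 2) ∧
      ellipticZeta p (-1 / 2) = 2 / (Real.pi : ℂ) *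
        (deriv (barnesZeta 1 2 p) (-1) + deriv (barnesZeta (1 + p) 2 p) (-1)
          - 1 / p * deriv (barnesZeta 1 1 1) (-1))) := by
  refine ⟨fun γ α β hγ hα hβ => ?_, fun p hp => ?_⟩
  · have hα0 : α ≠ 0 := fun h => by simp [h] at hα
    have hβ0 : β ≠ 0 := fun h => by simp [h] at hβ
    refine ⟨fun s hs => (hasSum_barnesTerm hγ hα hβ hs).summable,
      isMeromorphicContinuation_barnesZeta hγ hα hβ,
      fun s h1 h2 => analyticAt_barnesZeta hγ hα hβ h1 h2, ?_, barnesZeta_neg_one hγ hα hβ, ?_⟩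
    · rw [barnesZeta_neg_one hγ hα hβ, genBernoulli_three hα0 hβ0]
      field_simp
      ring
    · rw [genBernoulli_three hα0 hβ0, genBernoulli_three hα0 hβ0]
      ring
  · obtain ⟨hA, hval⟩ := ellipticZeta_neg_half hp
    refine ⟨fun t ht => integrableOn_exp_mul_ellipticBracket hp ht,
      fun s hs => (hasMellin_conformalHeatKernel hp (by linarith [hs.1]) hs.2).1,
      isMeromorphicContinuation_ellipticZeta hp, fun s h1 hs => ellipticZeta_eq hp h1 hs,
      barnesZeta_add_barnesZeta_neg_one hp, barnesZeta_one_one_one_neg_one, ?_, hA, hval⟩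
    -- Analyticity at `-1/2` makes the product continuous there, and its first factor vanishes at
    -- that point.
    have hc : ContinuousAt (fun s : ℂ => (s + 1 / 2) * ellipticZeta p s) (-1 / 2) :=
      ContinuousAt.mul (by fun_prop) hA.continuousAt
    have ht := hc.tendsto.mono_left (nhdsWithin_le_nhds (s := {(-1 / 2 : ℂ)}ᶜ))
    simpa [neg_div] using ht
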